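/- Consider $n\ge 1$ fermionic modes with annihilation operators $a_1,\dots,a_n$ on the $2^n$-dimensional Fock space, and Majorana operators $\gamma_{2\mu-1}=a_\mu+a_\mu^\dagger$, $\gamma_{2\mu}=i(a_\mu-a_\mu^\dagger)$. A unitary $U\in U(n)$ is implemented on Fock space by the operator $\hat U$ that fixes the vacuum and satisfies $\hat U a_\mu^\dagger \hat U^\dagger=\sum_\nu U_{\mu\nu}a_\nu^\dagger$. A *number-conserving Gaussian state* is a density matrix $\rho=\hat U^\dagger\rho_0\hat U$ with $U\in U(n)$ and $\rho_0=2^{-n}\prod_{\mu=1}^n(1+i\lambda_\mu\gamma_{2\mu-1}\gamma_{2\mu})$, $\lambda_\mu\in[-1,1]$. Its correlation matrix is $\mathcal M_{\mu\nu}=2\,\mathrm{Tr}(\rho\, a_\mu a_\nu^\dagger)-\delta_{\mu\nu}$, its proxy entropy is $S_{\mathrm{proxy}}(\rho)=(\log 2)(n-\mathrm{Tr}\,\mathcal M^2)$, and the density of the latter is $s(\rho)=S_{\mathrm{proxy}}(\rho)/(n\log 2)$. Measuring the occupation number of mode $1$ (projections $P_{\text{empty}}=a_1a_1^\dagger$ and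 $P_{\text{occ}}=a_1^\dagger a_1$) turns $\rho$ into $P_x\rho P_x/p_x$ with probability $p_x=\mathrm{Tr}(P_x\rho P_x)$; let $\Delta S_{\mathrm{proxy}}(\rho)=\sum_x p_x S_{\mathrm{proxy}}(P_x\rho P_x/p_x)-S_{\mathrm{proxy}}(\rho)$ (sum over outcomes with $p_x\neq0$). 1. Let $\rho$ be a number-conserving Gaussian state. Then $\mathcal M$ is Hermitian, each post-measurement state with $p_x\ne0$ is again a number-conserving Gaussian state, and, if $\mathcal M_{11}^2\neq 1$, $$\Delta S_{\mathrm{proxy}}(\rho)=-\frac{\log 2}{1-(\mathcal M_{11})^2}\bigl(1-(\mathcal M^2)_{11}\bigr)^2\le 0 ,$$ while $\Delta S_{\mathrm{proxy}}(\rho)=0$ if $\mathcal M_{11}^2=1$. 2. Let $P$ be an ensemble of number-conserving Gaussian states, that is, a Borel probability measure on operators that is concentrated on such states. Denote averages over $P$ by a bar, and let $\overline{\Delta S_{\mathrm{proxy}}}$ be the change of the average proxy entropy when the occupation number of mode $1$ is measured (and the outcome recorded). Then all these averages exist and $$\bigl|\overline{\Delta S_{\mathrm{proxy}}}\bigr|\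 \ge\ (\log 2)\,\overline{\bigl(1-(\mathcal M^2)_{11}\bigr)^2}\ \ge\ (\log 2)\Bigl(\overline{1-(\mathcal M^2)_{11}}\Bigr)^2 .$$ 3. Start from an arbitrary ensemble $P$ of number-conserving Gaussian states (for example the maximally mixed state) and repeat the following step: replace $\rho$ by $\hat U^\dagger\rho\,\hat U$ with a fresh independent Haar-random $U\in U(n)$, then measure the occupation number of mode $1$. Let $\overline{s}(t)$ be the average of $s$ over the resulting ensemble (over unitaries, outcomes and initial state) after $t=0,1,2,\dots$ steps. The ensemble at every time is a probability measure concentrated on number-conserving Gaussian states, the averages of $s$ and of the purity exist, and for all $t$ $$\overline s(t+1)\le\overline s(t),\qquad |\overline s(t+1)-\overline s(t)|\ \ge\ \frac1n\,\overline s(t)^2,\qquad \overline s(t)\ \le\ \Bigl(1+\frac tn\Bigr)^{-1}.$$ 4. Consequently the system purifies within a time of order $n^2$: for every real $c>0$ and every $t\ge c\,n^2$, the average proxy entropy after $t$ steps is at most $(\log 2)/c$, and the average purity $\overline{\mathrm{Tr}\,\rho^2}$ after $t$ steps is at least $2^{-1/c}$. -/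

import Mathlib

open MeasureTheory Matrix

noncomputable section

namespace FreeFermion

/-! ### The Fock space of `n` fermionic modes

The occupation-number basis of the `2 ^ n`-dimensional Fock space is indexed by the set
`S : Finset (Fin n)` of occupied modes; operators are matrices in this basis. -/

/-- Operators on the Fock space of `n` fermionic modes. -/
abbrev FockOp (n : ℕ) : Type := Matrix (Finset (Fin n)) (Finset (Fin n)) ℂ

/-- The annihilation operator `a_μ` (Jordan-Wigner form):
`a_μ |T⟩ = (-1) ^ #{ν ∈ T | ν < μ} |T \ {μ}⟩` if `μ ∈ T`, and `a_μ |T⟩ = 0` otherwise. -/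
def ann {n : ℕ} (μ : Fin n) : FockOp n :=
  Matrix.of fun S T =>
    if μ ∈ T ∧ S = T.erase μ then (-1 : ℂ) ^ (T.filter (fun ν => ν < μ)).card else 0

/-- The creation operator `a_μ†`. -/
def cre {n : ℕ} (μ : Fin n) : FockOp n := (ann μ)ᴴ

/-- The Majorana operator `γ_{2μ-1} = a_μ + a_μ†`. -/
def majoranaOdd {n : ℕ} (μ : Fin n) : FockOp n := ann μ + cre μ

/-- The Majorana operator `γ_{2μ} = i (a_μ - a_μ†)`. -/
def majoranaEven {n : ℕ} (μ : Fin n) : FockOp n := Complex.I • (ann μ - cre μ)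

/-- The product Gaussian state `ρ₀ = 2⁻ⁿ ∏_μ (1 + i λ_μ γ_{2μ-1} γ_{2μ})`
(the factors commute, the product is taken in increasing order of `μ`). -/
def productState {n : ℕ} (lam : Fin n → ℝ) : FockOp n :=
  ((1 : ℂ) / 2 ^ n) •
    ((List.finRange n).map fun μ =>
      (1 : FockOp n) + (Complex.I * (lam μ : ℂ)) • (majoranaOdd μ * majoranaEven μ)).prod

/-- The Fock space operator `Û` that implements the `n × n` unitary `U`:
it fixes the vacuum and satisfies `Û a_μ† Û† = ∑_ν U_{μν} a_ν†`, that is,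
`Û a_{μ₁}† ⋯ a_{μₖ}† |∅⟩ = (∑_ν U_{μ₁ν} a_ν†) ⋯ (∑_ν U_{μₖν} a_ν†) |∅⟩`
for `μ₁ < ⋯ < μₖ`. -/
def fockUnitary {n : ℕ} (U : Matrix (Fin n) (Fin n) ℂ) : FockOp n :=
  Matrix.of fun S T =>
    (((T.sort (fun i j => i ≤ j)).map fun μ => ∑ ν, U μ ν • (cre ν : FockOp n)).prod) S ∅

/-- The evolution `ρ ↦ Û† ρ Û` of a state under the free-fermion unitary given by `U`. -/
def conjState {n : ℕ} (U : Matrix (Fin n) (Fin n) ℂ) (ρ : FockOp n) : FockOp n :=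
  (fockUnitary U)ᴴ * ρ * fockUnitary U

/-- Number-conserving Gaussian states: the states `Û† ρ₀ Û` with `U ∈ U(n)` and
`ρ₀` a product Gaussian state with parameters `λ_μ ∈ [-1, 1]`. -/
def IsNumberConservingGaussian {n : ℕ} (ρ : FockOp n) : Prop :=
  ∃ (U : Matrix.unitaryGroup (Fin n) ℂ) (lam : Fin n → ℝ),
    (∀ μ, lam μ ∈ Set.Icc (-1 : ℝ) 1) ∧
      ρ = conjState (U : Matrix (Fin n) (Fin n) ℂ) (productState lam)

/-- The correlation matrix `𝓜_{μν} = 2 Tr (ρ a_μ a_ν†) - δ_{μν}`. -/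
def corr {n : ℕ} (ρ : FockOp n) : Matrix (Fin n) (Fin n) ℂ :=
  Matrix.of fun μ ν => 2 * (ρ * ann μ * cre ν).trace - if μ = ν then 1 else 0

/-- The proxy entropy `S_proxy (ρ) = (log 2) (n - Tr 𝓜²)`. -/
def proxyEntropy {n : ℕ} (ρ : FockOp n) : ℝ :=
  Real.log 2 * ((n : ℝ) - ((corr ρ * corr ρ).trace).re)

/-- The density `s = S_proxy / (n log 2)` of the proxy entropy. -/
def proxyDensity {n : ℕ} (ρ : FockOp n) : ℝ := proxyEntropy ρ / (n * Real.log 2)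

/-- The purity `Tr ρ²`. -/
def purity {n : ℕ} (ρ : FockOp n) : ℝ := ((ρ * ρ).trace).re

/-! ### Measuring the occupation number of the first mode -/

/-- The spectral projections of the occupation number of the first mode:
`a₁† a₁` for the outcome "occupied" (`true`), `a₁ a₁†` for the outcome "empty" (`false`). -/
def occProj {n : ℕ} [NeZero n] : Bool → FockOp n
  | true => cre 0 * ann 0
  | false => ann 0 * cre 0

/-- The probability of an outcome in the state `ρ`. -/
def outcomeProb {n : ℕ} [NeZero n] (x : Bool) (ρ : FockOp n) : ℝ :=
  ((occProj x * ρ * occProj x).trace).re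

/-- The normalized post-measurement state (meaningful if the outcome has nonzero probability). -/
def postState {n : ℕ} [NeZero n] (x : Bool) (ρ : FockOp n) : FockOp n :=
  ((outcomeProb x ρ : ℂ))⁻¹ • (occProj x * ρ * occProj x)

/-- The change of the proxy entropy of `ρ` under the measurement of the occupation number of the
first mode, averaged over the measurement outcomes. -/
def proxyChange {n : ℕ} [NeZero n] (ρ : FockOp n) : ℝ :=
  (∑ x : Bool, outcomeProb x ρ * proxyEntropy (postState x ρ)) - proxyEntropy ρ

/-! ### Ensembles of states and the hybrid unitary-measurement circuit -/

instance instMeasurableSpaceFockOp (n : ℕ) : MeasurableSpace (FockOp n) := borel _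

instance instBorelSpaceFockOp (n : ℕ) : BorelSpace (FockOp n) := ⟨rfl⟩

instance instMeasurableSpaceUnitaryGroup (n : ℕ) :
    MeasurableSpace (Matrix.unitaryGroup (Fin n) ℂ) := borel _

instance instBorelSpaceUnitaryGroup (n : ℕ) :
    BorelSpace (Matrix.unitaryGroup (Fin n) ℂ) := ⟨rfl⟩

instance instCompactSpaceUnitaryGroup (n : ℕ) :
    CompactSpace (Matrix.unitaryGroup (Fin n) ℂ) := by
  suffices h : IsCompact ((Matrix.unitaryGroup (Fin n) ℂ :
      Submonoid (Matrix (Fin n) (Fin n) ℂ)) : Set (Matrix (Fin n) (Fin n) ℂ)) from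
    isCompact_iff_compactSpace.1 h
  have hK : IsCompact (Set.univ.pi fun _ : Fin n => Set.univ.pi fun _ : Fin n =>
      Metric.closedBall (0 : ℂ) 1) :=
    isCompact_univ_pi fun _ => isCompact_univ_pi fun _ => isCompact_closedBall _ _
  refine IsCompact.of_isClosed_subset hK ?_ ?_
  · have h : ((Matrix.unitaryGroup (Fin n) ℂ : Submonoid (Matrix (Fin n) (Fin n) ℂ)) :
        Set (Matrix (Fin n) (Fin n) ℂ)) = {A | A * Aᴴ = 1} := by
      ext A
      exact Matrix.mem_unitaryGroup_iff
    rw [h]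
    exact isClosed_eq (continuous_id.matrix_mul continuous_id.matrix_conjTranspose)
      continuous_const
  · intro A hA
    refine Set.mem_univ_pi.2 fun i => Set.mem_univ_pi.2 fun j => ?_
    simpa using entry_norm_bound_of_unitary hA i j

/-- The normalized Haar measure on `U(n)`. -/
def haarUnitary (n : ℕ) : Measure (Matrix.unitaryGroup (Fin n) ℂ) :=
  Measure.haarMeasure ⊤

/-- The ensemble obtained from the ensemble `P` by applying to its states an independent
Haar-random free-fermion unitary. -/
def unitaryStep {n : ℕ} (P : Measure (FockOp n)) : Measure (FockOp n) :=
  ((haarUnitary n).prod P).map fun q => conjState (q.1 : Matrix (Fin n) (Fin n) ℂ) q.2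

/-- The ensemble obtained from the ensemble `P` by measuring the occupation number of the first
mode and recording the outcome: the state `ρ` turns into the state `postState x ρ` with
probability `outcomeProb x ρ`. -/
def measureStep {n : ℕ} [NeZero n] (P : Measure (FockOp n)) : Measure (FockOp n) :=
  ∑ x : Bool, (P.withDensity fun ρ => ENNReal.ofReal (outcomeProb x ρ)).map (postState x)

/-- The ensemble after `t` steps of the circuit, each step being a Haar-random free-fermion unitary
followed by a measurement of the occupation number of the first mode. -/
def evolve {n : ℕ} [NeZero n] (P : Measure (FockOp n)) (t : ℕ) : Measure (FockOp n) :=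
  (fun Q => measureStep (unitaryStep Q))^[t] P

end FreeFermion

end

/-!
Second quantization `A ↦ Â` (`fockUnitary`) makes sense for every matrix `A`, not only for unitary
ones.  Since the creation operators generate the Fock space from the vacuum
(`eq_zero_of_mul_cre`), an operator is determined by its action on the vacuum and its commutation
with the creation operators; this gives `V̂ Û = (U V)^`, `Â† = (A†)^`, and
`diag(d)^ = ∏_μ d_μ ^ {n_μ}`.

*Wick's relation.*  A product state satisfies `(1 - λ_μ) ρ₀ a_μ = (1 + λ_μ) a_μ ρ₀`, so cyclicity of
the trace gives `Tr (ρ₀ a_μ X) = (1 + λ_μ) / 2 * Tr (ρ₀ (a_μ X + X a_μ))` for *every* operator `X`.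
Rotating by `Û` one gets `Tr (ρ a_μ X) = ∑_ν G_{μν} Tr (ρ (a_ν X + X a_ν))` with
`G_{μν} = Tr (ρ a_μ a_ν†)` for every number-conserving Gaussian state (`trace_ann_mul`).  With
`σ = 1` for the outcome "empty" and `σ = -1` for "occupied", `e` the first basis vector and
`m = 𝓜₁₁`, it follows that the measurement turns `𝓜` into
`𝓜 - σ / (1 + σ m) (𝓜 + σ) e e† (𝓜 + σ) + 2 σ e e†` (`corr_postState`), and averaging `Tr 𝓜²` over
the two outcomes, which have probabilities `(1 + σ m) / 2`, yields the formula for the change of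
the proxy entropy (`proxyChange_eq`).

*Gaussianity after the measurement.*  If `A` is positive definite, the spectral theorem shows that
`Â` is a positive multiple of a Gaussian state.  For `|λ_μ| < 1` the state `ρ` is itself a multiple
of such an `Â`, and the projections are limits of multiples of `Ê` with `E` diagonal and positive;
as `Ê Â Ê = (E A E)^` and the set of Gaussian states is compact, hence closed, the
post-measurement state is Gaussian (`IsNumberConservingGaussian.postState`).

*The circuit.*  After a Haar-random unitary the ensemble is invariant under permutations of the
modes, so that the average of `1 - (𝓜²)₁₁` is the average density `s`
(`integral_one_sub_unitaryStep`).  With Jensen's inequality one step of the circuit gives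
`s' ≤ s - s² / n`, hence `s ≤ (1 + t / n)⁻¹`.  The purity follows from
`exp (-S_proxy) ≤ Tr ρ²` for Gaussian states and Jensen's inequality for the exponential.
-/

noncomputable section

namespace FreeFermion

variable {n : ℕ}

/-! ### The occupation-number basis and the anticommutation relations -/

/-- The occupation-number basis vector `|T⟩`. -/
def ket (T : Finset (Fin n)) : Finset (Fin n) → ℂ := Pi.single T 1

/-- The Jordan-Wigner sign `(-1) ^ #{ν ∈ T | ν < μ}`. -/
def jwSign (μ : Fin n) (T : Finset (Fin n)) : ℂ := (-1) ^ (T.filter (fun ν => ν < μ)).card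

lemma mulVec_ket (A : FockOp n) (S T : Finset (Fin n)) : (A *ᵥ ket T) S = A S T := by
  simp [ket]

lemma ext_ket {A B : FockOp n} (h : ∀ T, A *ᵥ ket T = B *ᵥ ket T) : A = B := by
  ext S T
  simpa [mulVec_ket] using congrFun (h T) S

lemma eq_zero_of_eq_neg {A : FockOp n} (h : A = -A) : A = 0 := by
  ext S T
  exact self_eq_neg.1 (congrFun (congrFun h S) T)

lemma jwSign_mul_self (μ : Fin n) (T : Finset (Fin n)) : jwSign μ T * jwSign μ T = 1 := by
  simp [jwSign, ← mul_pow]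

lemma jwSign_insert {μ ν : Fin n} {T : Finset (Fin n)} (h : ν ∉ T) :
    jwSign μ (insert ν T) = (if ν < μ then -1 else 1) * jwSign μ T := by
  unfold jwSign
  rw [Finset.filter_insert]
  split_ifs with h1
  · rw [Finset.card_insert_of_notMem (by simp [h]), pow_succ]; ring
  · simp

lemma jwSign_erase {μ ν : Fin n} {T : Finset (Fin n)} (h : ν ∈ T) :
    jwSign μ (T.erase ν) = (if ν < μ then -1 else 1) * jwSign μ T := by
  conv_rhs => rw [← Finset.insert_erase h, jwSign_insert (Finset.notMem_erase ν T)]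
  split_ifs <;> simp

lemma ann_mulVec_ket (μ : Fin n) (T : Finset (Fin n)) :
    ann μ *ᵥ ket T = if μ ∈ T then jwSign μ T • ket (T.erase μ) else 0 := by
  ext S
  rw [mulVec_ket]
  by_cases h : μ ∈ T <;> simp [ann, h, ket, Pi.single_apply, jwSign]

lemma cre_mulVec_ket (μ : Fin n) (T : Finset (Fin n)) :
    cre μ *ᵥ ket T = if μ ∈ T then 0 else jwSign μ T • ket (insert μ T) := by
  ext S
  rw [mulVec_ket]
  have key : (μ ∈ S ∧ T = S.erase μ) ↔ (μ ∉ T ∧ S = insert μ T) := by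
    constructor
    · rintro ⟨h, rfl⟩; simp [Finset.insert_erase h]
    · rintro ⟨h, rfl⟩; simp [Finset.erase_insert h]
  simp only [cre, ann, conjTranspose_apply, of_apply, key]
  by_cases h : μ ∈ T
  · simp [h]
  · simp only [h, not_false_eq_true, true_and, if_false, ket, Pi.smul_apply, Pi.single_apply]
    split_ifs with h1
    · subst h1
      have := jwSign_insert (μ := μ) h
      simp only [lt_irrefl, if_false, one_mul, jwSign] at this
      simp [this, jwSign]
    · simp

lemma ann_mul_ann (μ ν : Fin n) : (ann μ * ann ν : FockOp n) = -(ann ν * ann μ) := by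
  refine ext_ket fun T => ?_
  rw [neg_mulVec, ← mulVec_mulVec, ← mulVec_mulVec, ann_mulVec_ket, ann_mulVec_ket]
  rcases eq_or_ne μ ν with rfl | hne
  · split_ifs <;> simp [mulVec_smul, ann_mulVec_ket]
  by_cases h1 : μ ∈ T <;> by_cases h2 : ν ∈ T <;>
    simp [h1, h2, mulVec_smul, ann_mulVec_ket, hne, hne.symm]
  rw [Finset.erase_right_comm, ← smul_neg, ← neg_smul, smul_smul, smul_smul, jwSign_erase h1,
    jwSign_erase h2]
  congr 1
  rcases hne.lt_or_gt with h | h <;> simp [h, h.not_gt] <;> ring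

lemma cre_mul_cre (μ ν : Fin n) : (cre μ * cre ν : FockOp n) = -(cre ν * cre μ) := by
  have := congrArg conjTranspose (ann_mul_ann ν μ)
  simpa [cre] using this

lemma ann_mul_cre_add (μ ν : Fin n) :
    (ann μ * cre ν + cre ν * ann μ : FockOp n) = if μ = ν then 1 else 0 := by
  refine ext_ket fun T => ?_
  rw [add_mulVec, ← mulVec_mulVec, ← mulVec_mulVec, ann_mulVec_ket, cre_mulVec_ket]
  rcases eq_or_ne μ ν with rfl | hne
  · by_cases h : μ ∈ T
    · simp [h, mulVec_smul, cre_mulVec_ket, smul_smul, jwSign_erase, jwSign_mul_self,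
        Finset.insert_erase]
    · simp [h, mulVec_smul, ann_mulVec_ket, smul_smul, jwSign_insert, jwSign_mul_self]
  · by_cases h1 : μ ∈ T <;> by_cases h2 : ν ∈ T <;>
      simp [h1, h2, mulVec_smul, ann_mulVec_ket, cre_mulVec_ket, hne, hne.symm]
    rw [Finset.erase_insert_of_ne hne.symm, smul_smul, smul_smul, jwSign_erase h1,
      jwSign_insert h2, ← add_smul]
    rw [show _ + _ = (0 : ℂ) by
      rcases hne.lt_or_gt with h | h <;> simp [h, h.not_gt] <;> ring, zero_smul]

/-- Uniqueness principle: as the creation operators generate the Fock space from the vacuum, an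
operator that can be moved past all of them and kills the vacuum is zero. -/
lemma eq_zero_of_mul_cre {Z : FockOp n} (b : Fin n → FockOp n)
    (hZ : ∀ μ, Z * cre μ = b μ * Z) (h0 : Z *ᵥ ket ∅ = 0) : Z = 0 := by
  refine ext_ket fun T => ?_
  rw [zero_mulVec]
  induction T using Finset.induction_on with
  | empty => exact h0
  | insert a s ha ih =>
    have h1 : ket (insert a s) = jwSign a s • (cre a *ᵥ ket s) := by
      rw [cre_mulVec_ket, if_neg ha, smul_smul, jwSign_mul_self, one_smul]
    rw [h1, mulVec_smul, mulVec_mulVec, hZ, ← mulVec_mulVec, ih, mulVec_zero, smul_zero]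

/-! ### Second quantization -/

/-- The transformed creation operator `∑_ν A_{μν} a_ν†`. -/
def rotCre (A : Matrix (Fin n) (Fin n) ℂ) (μ : Fin n) : FockOp n := ∑ ν, A μ ν • cre ν

lemma rotCre_mul_rotCre (A : Matrix (Fin n) (Fin n) ℂ) (μ ν : Fin n) :
    rotCre A μ * rotCre A ν = -(rotCre A ν * rotCre A μ) := by
  simp only [rotCre, Finset.sum_mul_sum, ← Finset.sum_neg_distrib]
  rw [Finset.sum_comm]
  refine Finset.sum_congr rfl fun i _ => Finset.sum_congr rfl fun j _ => ?_
  rw [smul_mul_smul_comm, smul_mul_smul_comm, cre_mul_cre, smul_neg, mul_comm]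

/-- The ordered product `∏_{μ ∈ T} ∑_ν A_{μν} a_ν†`. -/
def rotCreProd (A : Matrix (Fin n) (Fin n) ℂ) (T : Finset (Fin n)) : FockOp n :=
  ((T.sort (fun i j => i ≤ j)).map (rotCre A)).prod

lemma rotCreProd_insert_min (A : Matrix (Fin n) (Fin n) ℂ) {a : Fin n} {s : Finset (Fin n)}
    (h : ∀ x ∈ s, a < x) : rotCreProd A (insert a s) = rotCre A a * rotCreProd A s := by
  unfold rotCreProd
  rw [Finset.sort_insert (h₁ := fun b hb => (h b hb).le) (h₂ := fun ha => (h a ha).false)]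
  simp

lemma fockUnitary_mulVec_ket (A : Matrix (Fin n) (Fin n) ℂ) (T : Finset (Fin n)) :
    fockUnitary A *ᵥ ket T = rotCreProd A T *ᵥ ket ∅ := by
  ext S
  rw [mulVec_ket, mulVec_ket]
  rfl

lemma fockUnitary_vacuum (A : Matrix (Fin n) (Fin n) ℂ) : fockUnitary A *ᵥ ket ∅ = ket ∅ := by
  rw [fockUnitary_mulVec_ket]
  simp [rotCreProd]

/-- Multiplication by a transformed creation operator acts on ordered products as the creation
operator acts on the occupation-number basis. -/
lemma rotCre_mul_rotCreProd (A : Matrix (Fin n) (Fin n) ℂ) (μ : Fin n) (T : Finset (Fin n)) :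
    rotCre A μ * rotCreProd A T =
      if μ ∈ T then 0 else jwSign μ T • rotCreProd A (insert μ T) := by
  have hsq : rotCre A μ * rotCre A μ = 0 := by
    exact eq_zero_of_eq_neg (rotCre_mul_rotCre A μ μ)
  induction T using Finset.induction_on_min with
  | empty =>
    simp only [Finset.notMem_empty, if_false]
    rw [rotCreProd_insert_min A (by simp)]
    simp [jwSign]
  | insert a s ha ih =>
    have has : a ∉ s := fun h => (ha a h).false
    rw [rotCreProd_insert_min A ha]
    rcases lt_trichotomy μ a with h | rfl | h
    · have hs : ∀ x ∈ insert a s, μ < x := by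
        intro x hx
        rcases Finset.mem_insert.1 hx with rfl | hx
        · exact h
        · exact h.trans (ha x hx)
      rw [if_neg fun hm => (hs μ hm).false, rotCreProd_insert_min A hs,
        rotCreProd_insert_min A ha, jwSign,
        Finset.filter_false_of_mem fun x hx => (hs x hx).not_gt]
      simp
    · rw [← mul_assoc, hsq]; simp
    · rw [← mul_assoc, rotCre_mul_rotCre, neg_mul, mul_assoc, ih]
      have hma : μ ≠ a := h.ne'
      by_cases hm : μ ∈ s
      · simp [hm]
      · have hi : ∀ x ∈ insert μ s, a < x := by
          intro x hx
          rcases Finset.mem_insert.1 hx with rfl | hx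
          · exact h
          · exact ha x hx
        rw [if_neg hm, if_neg (by simp [hm, hma]), Finset.insert_comm,
          rotCreProd_insert_min A hi, jwSign_insert has, if_pos h]
        simp

/-- The intertwining relation `Â a_μ† = (∑_ν A_{μν} a_ν†) Â`, for every matrix `A`. -/
lemma fockUnitary_mul_cre (A : Matrix (Fin n) (Fin n) ℂ) (μ : Fin n) :
    fockUnitary A * cre μ = rotCre A μ * fockUnitary A := by
  refine ext_ket fun T => ?_
  rw [← mulVec_mulVec, ← mulVec_mulVec, fockUnitary_mulVec_ket, mulVec_mulVec (ket ∅),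
    rotCre_mul_rotCreProd, cre_mulVec_ket]
  split_ifs
  · simp
  · rw [mulVec_smul, smul_mulVec, fockUnitary_mulVec_ket]

/-- Second quantization reverses products: `V̂ Û` implements `U V`. -/
lemma fockUnitary_mul (U V : Matrix (Fin n) (Fin n) ℂ) :
    fockUnitary V * fockUnitary U = fockUnitary (U * V) := by
  rw [← sub_eq_zero]
  refine eq_zero_of_mul_cre (rotCre (U * V)) (fun μ => ?_) ?_
  · have h : fockUnitary V * rotCre U μ = rotCre (U * V) μ * fockUnitary V := by
      simp only [rotCre, Finset.mul_sum, mul_smul_comm, fockUnitary_mul_cre, Finset.sum_mul,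
        smul_mul_assoc, Matrix.mul_apply, Finset.smul_sum, smul_smul, Finset.sum_smul]
      rw [Finset.sum_comm]
    rw [sub_mul, mul_sub, mul_assoc, fockUnitary_mul_cre, fockUnitary_mul_cre, ← mul_assoc, h,
      mul_assoc]
  · rw [sub_mulVec, ← mulVec_mulVec, fockUnitary_vacuum, fockUnitary_vacuum, fockUnitary_vacuum,
      sub_self]

lemma ann_mulVec_vacuum (μ : Fin n) : (ann μ : FockOp n) *ᵥ ket ∅ = 0 := by
  simp [ann_mulVec_ket]

lemma ann_mul_rotCre_add (A : Matrix (Fin n) (Fin n) ℂ) (μ ν : Fin n) :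
    ann μ * rotCre A ν + rotCre A ν * ann μ = A ν μ • (1 : FockOp n) := by
  simp only [rotCre, Finset.mul_sum, Finset.sum_mul, mul_smul_comm, smul_mul_assoc,
    ← Finset.sum_add_distrib, ← smul_add, ann_mul_cre_add]
  simp

/-- The counterpart of `fockUnitary_mul_cre` for annihilation operators. For a matrix that is not
unitary it is not the adjoint of that relation. -/
lemma ann_mul_fockUnitary (A : Matrix (Fin n) (Fin n) ℂ) (μ : Fin n) :
    ann μ * fockUnitary A = fockUnitary A * ∑ κ, A κ μ • ann κ := by
  rw [← sub_eq_zero]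
  refine eq_zero_of_mul_cre (fun a => -rotCre A a) (fun a => ?_) ?_
  · have h1 : (∑ κ, A κ μ • ann κ) * cre a =
        A a μ • (1 : FockOp n) - cre a * ∑ κ, A κ μ • ann κ := by
      rw [eq_sub_iff_add_eq]
      simp only [Finset.mul_sum, Finset.sum_mul, mul_smul_comm, smul_mul_assoc,
        ← Finset.sum_add_distrib, ← smul_add, ann_mul_cre_add]
      simp
    have h2 := eq_sub_of_add_eq (ann_mul_rotCre_add A μ a)
    rw [sub_mul, mul_assoc, mul_assoc, h1, fockUnitary_mul_cre, ← mul_assoc, h2, mul_sub,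
      ← mul_assoc (fockUnitary A) (cre a), fockUnitary_mul_cre]
    simp only [sub_mul, mul_sub, neg_mul, smul_mul_assoc, mul_smul_comm, one_mul, mul_one,
      mul_assoc]
    abel
  · rw [sub_mulVec, ← mulVec_mulVec, fockUnitary_vacuum, ← mulVec_mulVec, sum_mulVec]
    simp [smul_mulVec, ann_mulVec_vacuum]

lemma rotCre_vacuum_row (A : Matrix (Fin n) (Fin n) ℂ) (μ : Fin n) (T : Finset (Fin n)) :
    rotCre A μ ∅ T = 0 := by
  simp [rotCre, Matrix.sum_apply, cre, ann]

/-- The operator `Â` maps no state with particles to the vacuum. -/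
lemma fockUnitary_vacuum_row (A : Matrix (Fin n) (Fin n) ℂ) (T : Finset (Fin n)) :
    fockUnitary A ∅ T = ket ∅ T := by
  rw [← mulVec_ket (fockUnitary A) ∅ T, fockUnitary_mulVec_ket, mulVec_ket]
  induction T using Finset.induction_on_min with
  | empty => simp [rotCreProd, ket]
  | insert a s ha ih =>
    rw [rotCreProd_insert_min A ha, Matrix.mul_apply]
    simp [rotCre_vacuum_row, ket]

lemma conjTranspose_rotCre (A : Matrix (Fin n) (Fin n) ℂ) (μ : Fin n) :
    (rotCre A μ)ᴴ = ∑ ν, star (A μ ν) • ann ν := by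
  simp [rotCre, conjTranspose_sum, cre]

/-- Second quantization is compatible with adjoints. -/
lemma conjTranspose_fockUnitary (A : Matrix (Fin n) (Fin n) ℂ) :
    (fockUnitary A)ᴴ = fockUnitary Aᴴ := by
  rw [← conjTranspose_inj, conjTranspose_conjTranspose, ← sub_eq_zero]
  refine eq_zero_of_mul_cre (rotCre A) (fun μ => ?_) ?_
  · have h := congrArg conjTranspose (ann_mul_fockUnitary Aᴴ μ)
    rw [conjTranspose_mul, conjTranspose_mul] at h
    have h2 : (∑ κ, Aᴴ κ μ • ann κ : FockOp n)ᴴ = rotCre A μ := by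
      rw [← conjTranspose_conjTranspose (rotCre A μ), conjTranspose_rotCre]
      rfl
    rw [h2] at h
    rw [sub_mul, mul_sub, fockUnitary_mul_cre, cre, h]
  · ext S
    rw [sub_mulVec, fockUnitary_vacuum, Pi.sub_apply, mulVec_ket, conjTranspose_apply,
      fockUnitary_vacuum_row]
    by_cases hS : S = ∅ <;> simp [ket, hS]

lemma diagonal_mulVec_ket (w : Finset (Fin n) → ℂ) (T : Finset (Fin n)) :
    (diagonal w : FockOp n) *ᵥ ket T = w T • ket T := by
  ext S
  rw [mulVec_ket]
  by_cases h : S = T <;> simp [ket, h]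

/-- The second quantization of a diagonal matrix `d` is `∏_μ d_μ ^ {n_μ}`. -/
lemma fockUnitary_diagonal (d : Fin n → ℂ) :
    fockUnitary (diagonal d) = diagonal fun S => ∏ μ ∈ S, d μ := by
  rw [← sub_eq_zero]
  refine eq_zero_of_mul_cre (rotCre (diagonal d)) (fun μ => ?_) ?_
  · rw [sub_mul, mul_sub, fockUnitary_mul_cre]
    congr 1
    refine ext_ket fun T => ?_
    have hr : rotCre (diagonal d) μ = d μ • cre μ := by
      simp [rotCre, diagonal_apply]
    rw [← mulVec_mulVec, ← mulVec_mulVec, diagonal_mulVec_ket, mulVec_smul, hr, smul_mulVec,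
      cre_mulVec_ket]
    split_ifs with h
    · simp
    · rw [mulVec_smul, diagonal_mulVec_ket, Finset.prod_insert h]
      simp only [smul_smul]
      congr 1; ring
  · rw [sub_mulVec, fockUnitary_vacuum, diagonal_mulVec_ket]
    simp

lemma fockUnitary_one : fockUnitary (1 : Matrix (Fin n) (Fin n) ℂ) = 1 := by
  rw [← diagonal_one, fockUnitary_diagonal]
  simp

lemma fockUnitary_conjTranspose_mul (U : unitaryGroup (Fin n) ℂ) :
    (fockUnitary (U : Matrix (Fin n) (Fin n) ℂ))ᴴ * fockUnitary (U : Matrix (Fin n) (Fin n) ℂ)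
      = 1 := by
  rw [conjTranspose_fockUnitary, fockUnitary_mul, ← star_eq_conjTranspose,
    mem_unitaryGroup_iff.1 U.2, fockUnitary_one]

lemma fockUnitary_mul_conjTranspose (U : unitaryGroup (Fin n) ℂ) :
    fockUnitary (U : Matrix (Fin n) (Fin n) ℂ) * (fockUnitary (U : Matrix (Fin n) (Fin n) ℂ))ᴴ
      = 1 := by
  rw [conjTranspose_fockUnitary, fockUnitary_mul, ← star_eq_conjTranspose,
    mem_unitaryGroup_iff'.1 U.2, fockUnitary_one]

/-! ### Product states -/

/-- The weight of the occupation-number state `|S⟩` in the product state. -/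
def occWeight (lam : Fin n → ℝ) (S : Finset (Fin n)) : ℝ :=
  ∏ μ, if μ ∈ S then (1 - lam μ) / 2 else (1 + lam μ) / 2

lemma cre_mul_ann_eq_diagonal (μ : Fin n) :
    (cre μ * ann μ : FockOp n) = diagonal fun S => if μ ∈ S then 1 else 0 := by
  refine ext_ket fun T => ?_
  rw [← mulVec_mulVec, ann_mulVec_ket, diagonal_mulVec_ket]
  split_ifs with h
  · simp [mulVec_smul, cre_mulVec_ket, smul_smul, jwSign_erase, h, jwSign_mul_self,
      Finset.insert_erase]
  · simp

lemma ann_mul_cre_eq_diagonal (μ : Fin n) :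
    (ann μ * cre μ : FockOp n) = diagonal fun S => if μ ∈ S then 0 else 1 := by
  have h := ann_mul_cre_add μ μ
  rw [if_pos rfl] at h
  rw [eq_sub_of_add_eq h, cre_mul_ann_eq_diagonal, ← diagonal_one, diagonal_sub]
  congr 1; ext S; split_ifs <;> simp

lemma majorana_factor (μ : Fin n) (l : ℝ) :
    (1 : FockOp n) + (Complex.I * (l : ℂ)) • (majoranaOdd μ * majoranaEven μ) =
      diagonal fun S => if μ ∈ S then 1 - (l : ℂ) else 1 + l := by
  have h1 : (ann μ * ann μ : FockOp n) = 0 := eq_zero_of_eq_neg (ann_mul_ann μ μ)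
  have h2 : (cre μ * cre μ : FockOp n) = 0 := eq_zero_of_eq_neg (cre_mul_cre μ μ)
  have h3 : (majoranaOdd μ * majoranaEven μ : FockOp n) =
      Complex.I • (cre μ * ann μ - ann μ * cre μ) := by
    simp only [majoranaOdd, majoranaEven, mul_smul_comm, add_mul, mul_sub, h1, h2]
    congr 1; abel
  rw [h3, cre_mul_ann_eq_diagonal, ann_mul_cre_eq_diagonal, smul_smul, diagonal_sub,
    ← diagonal_smul, ← diagonal_one, diagonal_add]
  congr 1; ext S
  have : Complex.I * (l : ℂ) * Complex.I = -l := by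
    rw [mul_right_comm, Complex.I_mul_I]; ring
  simp only [Pi.smul_apply, smul_eq_mul, this]
  split_ifs <;> ring

lemma productState_eq_diagonal (lam : Fin n → ℝ) :
    productState lam = diagonal fun S => (occWeight lam S : ℂ) := by
  unfold productState
  simp only [majorana_factor]
  have h := map_list_prod (diagonalRingHom (Finset (Fin n)) ℂ) ((List.finRange n).map
    fun μ S => if μ ∈ S then 1 - (lam μ : ℂ) else 1 + lam μ)
  rw [List.map_map] at h
  simp only [Function.comp_def, diagonalRingHom_apply] at h
  rw [← h, ← Fin.prod_univ_def, ← diagonal_smul]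
  congr 1; ext S
  simp only [Pi.smul_apply, Finset.prod_apply, smul_eq_mul, occWeight]
  have h2 : (1 : ℂ) / 2 ^ n = ∏ _μ : Fin n, (1 / 2 : ℂ) := by simp
  rw [h2, ← Finset.prod_mul_distrib, Complex.ofReal_prod]
  refine Finset.prod_congr rfl fun μ _ => ?_
  split_ifs <;> push_cast <;> ring

/-- Power sums of the weights; `k = 1` gives the trace of a product state, `k = 2` its purity. -/
lemma sum_occWeight_pow (lam : Fin n → ℝ) (k : ℕ) :
    ∑ S, occWeight lam S ^ k = ∏ μ, (((1 - lam μ) / 2) ^ k + ((1 + lam μ) / 2) ^ k) := by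
  rw [Finset.prod_add, Finset.powerset_univ]
  refine Finset.sum_congr rfl fun S _ => ?_
  rw [occWeight, ← Finset.prod_pow, ← Finset.prod_mul_prod_compl S, ← Finset.compl_eq_univ_sdiff]
  congr 1
  · exact Finset.prod_congr rfl fun μ h => by rw [if_pos h]
  · exact Finset.prod_congr rfl fun μ h => by rw [if_neg (Finset.mem_compl.1 h)]

lemma trace_productState (lam : Fin n → ℝ) : (productState lam).trace = 1 := by
  rw [productState_eq_diagonal, trace_diagonal, ← Complex.ofReal_sum]
  have h := sum_occWeight_pow lam 1
  simp only [pow_one] at h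
  rw [h, Finset.prod_eq_one fun μ _ => by ring, Complex.ofReal_one]

lemma occWeight_erase (lam : Fin n → ℝ) {μ : Fin n} {T : Finset (Fin n)} (h : μ ∈ T) :
    (1 - lam μ) * occWeight lam (T.erase μ) = (1 + lam μ) * occWeight lam T := by
  unfold occWeight
  rw [← Finset.mul_prod_erase _ _ (Finset.mem_univ μ),
    ← Finset.mul_prod_erase Finset.univ (fun κ => if κ ∈ T then _ else _) (Finset.mem_univ μ)]
  have : ∏ κ ∈ Finset.univ.erase μ, (if κ ∈ T.erase μ then (1 - lam κ) / 2 else (1 + lam κ) / 2) =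
      ∏ κ ∈ Finset.univ.erase μ, (if κ ∈ T then (1 - lam κ) / 2 else (1 + lam κ) / 2) :=
    Finset.prod_congr rfl fun κ hκ => by simp [Finset.ne_of_mem_erase hκ]
  rw [this]
  simp only [Finset.notMem_erase, if_false, h, if_true]
  ring

/-- Commutation of a product state with `a_μ`, in a form that includes `λ_μ = ±1`. -/
lemma productState_mul_ann (lam : Fin n → ℝ) (μ : Fin n) :
    (1 - (lam μ : ℂ)) • (productState lam * ann μ) =
      (1 + (lam μ : ℂ)) • (ann μ * productState lam) := by
  refine ext_ket fun T => ?_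
  rw [productState_eq_diagonal, smul_mulVec, smul_mulVec, ← mulVec_mulVec, ← mulVec_mulVec,
    diagonal_mulVec_ket, mulVec_smul, ann_mulVec_ket]
  split_ifs with h
  · rw [mulVec_smul, diagonal_mulVec_ket]
    simp only [smul_smul]
    have := congrArg Complex.ofReal (occWeight_erase lam h)
    push_cast at this
    congr 1
    linear_combination jwSign μ T * this
  · simp

/-! ### Correlation matrices and Wick's relation -/

lemma fockUnitary_mul_ann (U : unitaryGroup (Fin n) ℂ) (μ : Fin n) :
    fockUnitary (U : Matrix (Fin n) (Fin n) ℂ) * ann μ =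
      (rotCre (U : Matrix (Fin n) (Fin n) ℂ) μ)ᴴ * fockUnitary (U : Matrix (Fin n) (Fin n) ℂ) := by
  set F := fockUnitary (U : Matrix (Fin n) (Fin n) ℂ)
  have h := congrArg conjTranspose (fockUnitary_mul_cre (U : Matrix (Fin n) (Fin n) ℂ) μ)
  rw [conjTranspose_mul, conjTranspose_mul, cre, conjTranspose_conjTranspose] at h
  have h2 : F * (ann μ * Fᴴ) * F = F * (Fᴴ * (rotCre (U : Matrix (Fin n) (Fin n) ℂ) μ)ᴴ) * F := by
    rw [h]
  rw [← mul_assoc, mul_assoc, fockUnitary_conjTranspose_mul, mul_one, ← mul_assoc,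
    fockUnitary_mul_conjTranspose, one_mul] at h2
  exact h2

lemma trace_conjState_mul (U : Matrix (Fin n) (Fin n) ℂ) (ρ X : FockOp n) :
    (conjState U ρ * X).trace = (ρ * (fockUnitary U * X * (fockUnitary U)ᴴ)).trace := by
  rw [conjState, mul_assoc, mul_assoc, trace_mul_comm]
  simp only [mul_assoc]

lemma trace_conjState (U : unitaryGroup (Fin n) ℂ) (ρ : FockOp n) :
    (conjState (U : Matrix (Fin n) (Fin n) ℂ) ρ).trace = ρ.trace := by
  have := trace_conjState_mul (U : Matrix (Fin n) (Fin n) ℂ) ρ 1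
  rwa [mul_one, mul_one, fockUnitary_mul_conjTranspose, mul_one] at this

/-- The two-point function `G_{μν} = Tr (ρ a_μ a_ν†)`. -/
def green (ρ : FockOp n) : Matrix (Fin n) (Fin n) ℂ :=
  Matrix.of fun μ ν => (ρ * ann μ * cre ν).trace

lemma corr_eq_green (ρ : FockOp n) : corr ρ = (2 : ℂ) • green ρ - 1 := by
  ext μ ν
  simp [corr, green, Matrix.one_apply]

lemma green_conjState (U : unitaryGroup (Fin n) ℂ) (ρ : FockOp n) :
    green (conjState (U : Matrix (Fin n) (Fin n) ℂ) ρ) =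
      (U : Matrix (Fin n) (Fin n) ℂ).map star * green ρ * (U : Matrix (Fin n) (Fin n) ℂ)ᵀ := by
  ext μ ν
  simp only [green, of_apply]
  rw [mul_assoc, trace_conjState_mul, ← mul_assoc (fockUnitary _) (ann μ), fockUnitary_mul_ann,
    mul_assoc _ _ (cre ν), fockUnitary_mul_cre, mul_assoc, mul_assoc, mul_assoc,
    fockUnitary_mul_conjTranspose, mul_one, conjTranspose_rotCre]
  simp only [rotCre, Matrix.mul_apply, Finset.mul_sum, Finset.sum_mul, trace_sum, of_apply,
    transpose_apply, map_apply, mul_smul_comm, smul_mul_assoc, trace_smul, smul_eq_mul]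
  rw [Finset.sum_comm]
  refine Finset.sum_congr rfl fun i _ => Finset.sum_congr rfl fun j _ => ?_
  rw [mul_assoc ρ]; ring

/-- Wick's relation for a product state: `a_μ` is moved around the trace with
`productState_mul_ann`. No parity of `X` is needed. -/
lemma trace_productState_ann (lam : Fin n → ℝ) (μ : Fin n) (X : FockOp n) :
    (productState lam * (ann μ * X)).trace =
      (1 + (lam μ : ℂ)) / 2 * (productState lam * (ann μ * X + X * ann μ)).trace := by
  have h := congrArg (fun A => (A * X).trace) (productState_mul_ann lam μ)
  simp only [smul_mul_assoc, trace_smul, smul_eq_mul] at h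
  rw [mul_assoc, mul_assoc (ann μ), trace_mul_comm (ann μ), mul_assoc] at h
  rw [mul_add, trace_add]
  linear_combination h / 2

lemma green_productState (lam : Fin n → ℝ) :
    green (productState lam) = diagonal fun μ => (1 + (lam μ : ℂ)) / 2 := by
  ext μ ν
  rw [green, of_apply, mul_assoc, trace_productState_ann, ann_mul_cre_add]
  by_cases h : μ = ν
  · subst h; simp [trace_productState]
  · simp [h]

lemma map_star_mem_unitaryGroup (U : unitaryGroup (Fin n) ℂ) :
    (U : Matrix (Fin n) (Fin n) ℂ).map star ∈ unitaryGroup (Fin n) ℂ := by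
  rw [mem_unitaryGroup_iff, star_eq_conjTranspose]
  have h := congrArg transpose (mem_unitaryGroup_iff.1 U.2)
  rw [transpose_mul, transpose_one, star_eq_conjTranspose] at h
  rw [← h]
  congr 1
  ext i j; simp

lemma conjTranspose_map_star (U : Matrix (Fin n) (Fin n) ℂ) : (U.map star)ᴴ = Uᵀ := by
  ext i j; simp

lemma corr_conjState (U : unitaryGroup (Fin n) ℂ) (ρ : FockOp n) :
    corr (conjState (U : Matrix (Fin n) (Fin n) ℂ) ρ) =
      (U : Matrix (Fin n) (Fin n) ℂ).map star * corr ρ *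
        ((U : Matrix (Fin n) (Fin n) ℂ).map star)ᴴ := by
  have h := mem_unitaryGroup_iff.1 (map_star_mem_unitaryGroup U)
  rw [star_eq_conjTranspose] at h
  rw [corr_eq_green, corr_eq_green, green_conjState, mul_sub, sub_mul, mul_one, h,
    conjTranspose_map_star, mul_smul_comm, smul_mul_assoc]

lemma corr_productState (lam : Fin n → ℝ) :
    corr (productState lam) = diagonal fun μ => (lam μ : ℂ) := by
  rw [corr_eq_green, green_productState, ← diagonal_one, ← diagonal_smul, diagonal_sub]
  congr 1; ext μ; simp; ring

lemma IsNumberConservingGaussian.trace_eq_one {ρ : FockOp n} (h : IsNumberConservingGaussian ρ) :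
    ρ.trace = 1 := by
  obtain ⟨U, lam, -, rfl⟩ := h
  rw [trace_conjState, trace_productState]

lemma IsNumberConservingGaussian.exists_corr_eq {ρ : FockOp n}
    (h : IsNumberConservingGaussian ρ) :
    ∃ (V : unitaryGroup (Fin n) ℂ) (lam : Fin n → ℝ), (∀ μ, lam μ ∈ Set.Icc (-1 : ℝ) 1) ∧
      corr ρ = (V : Matrix (Fin n) (Fin n) ℂ) * (diagonal fun μ => (lam μ : ℂ)) *
        (V : Matrix (Fin n) (Fin n) ℂ)ᴴ := by
  obtain ⟨U, lam, hl, rfl⟩ := h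
  exact ⟨⟨_, map_star_mem_unitaryGroup U⟩, lam, hl, by rw [corr_conjState, corr_productState]⟩

lemma IsNumberConservingGaussian.isHermitian_corr {ρ : FockOp n}
    (h : IsNumberConservingGaussian ρ) : (corr ρ).IsHermitian := by
  obtain ⟨V, lam, -, h⟩ := h.exists_corr_eq
  rw [h]
  refine isHermitian_mul_mul_conjTranspose _ ?_
  rw [IsHermitian, diagonal_conjTranspose]
  congr 1; ext; simp

/-- Wick's relation: contracting `a_μ` with the other factors of a product. -/
lemma IsNumberConservingGaussian.trace_ann_mul {ρ : FockOp n}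
    (h : IsNumberConservingGaussian ρ) (μ : Fin n) (X : FockOp n) :
    (ρ * (ann μ * X)).trace = ∑ ν, green ρ μ ν * (ρ * (ann ν * X + X * ann ν)).trace := by
  obtain ⟨U, lam, -, rfl⟩ := h
  set F := fockUnitary (U : Matrix (Fin n) (Fin n) ℂ) with hF
  -- rotate everything to the product state, where the relation is diagonal
  set Y := F * X * Fᴴ with hY
  set c : Fin n → ℂ := fun κ => (productState lam * (ann κ * Y + Y * ann κ)).trace with hc
  have hFF : Fᴴ * F = 1 := fockUnitary_conjTranspose_mul U
  have h1 : ∀ ν, F * (ann ν * X) * Fᴴ = (rotCre (U : Matrix (Fin n) (Fin n) ℂ) ν)ᴴ * Y := by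
    intro ν
    rw [← mul_assoc, fockUnitary_mul_ann, hY]; simp only [mul_assoc]; rfl
  have h2 : ∀ ν, F * (X * ann ν) * Fᴴ = Y * (rotCre (U : Matrix (Fin n) (Fin n) ℂ) ν)ᴴ := by
    intro ν
    have : Y * (rotCre (U : Matrix (Fin n) (Fin n) ℂ) ν)ᴴ =
        F * X * Fᴴ * ((rotCre (U : Matrix (Fin n) (Fin n) ℂ) ν)ᴴ * F) * Fᴴ := by
      rw [mul_assoc _ _ Fᴴ, mul_assoc _ F, fockUnitary_mul_conjTranspose, mul_one]
    rw [this, ← fockUnitary_mul_ann, ← hF, mul_assoc (F * X), ← mul_assoc Fᴴ F, hFF, one_mul]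
    simp only [mul_assoc]
  have hL : (conjState (U : Matrix (Fin n) (Fin n) ℂ) (productState lam) * (ann μ * X)).trace =
      ∑ κ, star ((U : Matrix (Fin n) (Fin n) ℂ) μ κ) * ((1 + (lam κ : ℂ)) / 2 * c κ) := by
    rw [trace_conjState_mul, h1, conjTranspose_rotCre]
    simp only [Finset.sum_mul, Finset.mul_sum, trace_sum, smul_mul_assoc, mul_smul_comm,
      trace_smul, smul_eq_mul, trace_productState_ann, hc]
  have hR : ∀ ν, (conjState (U : Matrix (Fin n) (Fin n) ℂ) (productState lam) *
      (ann ν * X + X * ann ν)).trace =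
      ∑ κ, star ((U : Matrix (Fin n) (Fin n) ℂ) ν κ) * c κ := by
    intro ν
    rw [trace_conjState_mul, mul_add F, add_mul _ _ Fᴴ, h1, h2, conjTranspose_rotCre]
    simp only [Finset.sum_mul, Finset.mul_sum, smul_mul_assoc, mul_smul_comm,
      ← Finset.sum_add_distrib, ← smul_add, trace_sum, trace_smul, smul_eq_mul, hc]
  have hG : green (conjState (U : Matrix (Fin n) (Fin n) ℂ) (productState lam)) *
      (U : Matrix (Fin n) (Fin n) ℂ).map star = (U : Matrix (Fin n) (Fin n) ℂ).map star *
        diagonal fun μ => (1 + (lam μ : ℂ)) / 2 := by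
    have h := mem_unitaryGroup_iff'.1 (map_star_mem_unitaryGroup U)
    rw [star_eq_conjTranspose, conjTranspose_map_star] at h
    rw [green_conjState, mul_assoc, h, mul_one, green_productState]
  rw [hL]
  simp only [hR, Finset.mul_sum]
  rw [Finset.sum_comm]
  refine Finset.sum_congr rfl fun κ _ => ?_
  have hG' := congrFun (congrFun hG μ) κ
  rw [mul_diagonal, Matrix.mul_apply] at hG'
  simp only [map_apply] at hG'
  rw [← mul_assoc, ← hG', Finset.sum_mul]
  exact Finset.sum_congr rfl fun ν _ => by ring

/-- The eigenvalues `λ_μ` of the correlation matrix lie in `[-1, 1]`, so `𝓜² ≤ 1`. -/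
lemma IsNumberConservingGaussian.corr_sq_apply_re_le_one {ρ : FockOp n}
    (h : IsNumberConservingGaussian ρ) (μ : Fin n) : ((corr ρ * corr ρ) μ μ).re ≤ 1 := by
  obtain ⟨V, lam, hl, h⟩ := h.exists_corr_eq
  have hV := mem_unitaryGroup_iff'.1 V.2
  rw [star_eq_conjTranspose] at hV
  have hV2 := mem_unitaryGroup_iff.1 V.2
  rw [star_eq_conjTranspose] at hV2
  have h2 : corr ρ * corr ρ = (V : Matrix (Fin n) (Fin n) ℂ) *
      (diagonal fun μ => ((lam μ ^ 2 : ℝ) : ℂ)) * (V : Matrix (Fin n) (Fin n) ℂ)ᴴ := by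
    rw [h]
    simp only [mul_assoc]
    rw [← mul_assoc _ (V : Matrix (Fin n) (Fin n) ℂ), hV, one_mul, ← mul_assoc (diagonal _),
      diagonal_mul_diagonal]
    simp [sq]
  have h3 : ∀ w : Fin n → ℝ, (((V : Matrix (Fin n) (Fin n) ℂ) *
      (diagonal fun μ => (w μ : ℂ)) * (V : Matrix (Fin n) (Fin n) ℂ)ᴴ) μ μ).re =
      ∑ κ, w κ * ‖(V : Matrix (Fin n) (Fin n) ℂ) μ κ‖ ^ 2 := by
    intro w
    rw [Matrix.mul_apply, Complex.re_sum]
    refine Finset.sum_congr rfl fun κ _ => ?_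
    rw [mul_diagonal, conjTranspose_apply, Complex.star_def, mul_right_comm, Complex.mul_conj',
      ← Complex.ofReal_pow, ← Complex.ofReal_mul, Complex.ofReal_re]
    ring
  rw [h2, h3]
  have h4 := h3 fun _ => 1
  simp only [Complex.ofReal_one, diagonal_one, mul_one, hV2, one_mul, one_apply_eq,
    Complex.one_re] at h4
  rw [h4]
  refine Finset.sum_le_sum fun κ _ => mul_le_of_le_one_left (by positivity) ?_
  obtain ⟨h5, h6⟩ := hl κ
  nlinarith

lemma hermitian_sq_apply_re {M : Matrix (Fin n) (Fin n) ℂ} (h : M.IsHermitian) (μ : Fin n) :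
    ((M * M) μ μ).re = ∑ ν, ‖M μ ν‖ ^ 2 := by
  rw [Matrix.mul_apply, Complex.re_sum]
  refine Finset.sum_congr rfl fun κ _ => ?_
  rw [← h.apply κ μ, Complex.star_def, Complex.mul_conj', ← Complex.ofReal_pow, Complex.ofReal_re]

lemma hermitian_apply_self {M : Matrix (Fin n) (Fin n) ℂ} (h : M.IsHermitian) (μ : Fin n) :
    M μ μ = ((M μ μ).re : ℂ) :=
  (Complex.conj_eq_iff_re.1 (h.apply μ μ)).symm

lemma IsNumberConservingGaussian.sum_norm_corr_sq_le {ρ : FockOp n}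
    (h : IsNumberConservingGaussian ρ) (μ : Fin n) : ∑ ν, ‖corr ρ μ ν‖ ^ 2 ≤ 1 := by
  rw [← hermitian_sq_apply_re h.isHermitian_corr]
  exact h.corr_sq_apply_re_le_one μ

lemma IsNumberConservingGaussian.corr_re_sq_le {ρ : FockOp n}
    (h : IsNumberConservingGaussian ρ) (μ : Fin n) :
    (corr ρ μ μ).re ^ 2 ≤ ((corr ρ * corr ρ) μ μ).re := by
  rw [hermitian_sq_apply_re h.isHermitian_corr]
  refine le_trans ?_ (Finset.single_le_sum (f := fun ν => ‖corr ρ μ ν‖ ^ 2)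
    (fun _ _ => by positivity) (Finset.mem_univ μ))
  rw [← sq_abs]
  gcongr
  exact Complex.abs_re_le_norm _

/-! ### The occupation measurement -/

section Measurement

variable [NeZero n]

/-- The eigenvalue of `1 - 2 n₁` for each outcome: `+1` for empty and `-1` for occupied. -/
def occSign : Bool → ℝ
  | true => -1
  | false => 1

lemma occSign_mul_self (x : Bool) : occSign x * occSign x = 1 := by
  cases x <;> simp [occSign]

lemma occProj_true_eq : (occProj true : FockOp n) = 1 - occProj false := by
  have h := ann_mul_cre_add (0 : Fin n) 0
  rw [if_pos rfl] at h
  exact eq_sub_of_add_eq' h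

lemma occProj_eq_diagonal (x : Bool) :
    (occProj x : FockOp n) = diagonal fun S => if decide ((0 : Fin n) ∈ S) = x then 1 else 0 := by
  cases x
  · simp only [occProj, ann_mul_cre_eq_diagonal]
    congr 1; ext S; by_cases h : (0 : Fin n) ∈ S <;> simp [h]
  · simp only [occProj, cre_mul_ann_eq_diagonal]
    congr 1; ext S; by_cases h : (0 : Fin n) ∈ S <;> simp [h]

lemma occProj_mul_self (x : Bool) : (occProj x * occProj x : FockOp n) = occProj x := by
  rw [occProj_eq_diagonal, diagonal_mul_diagonal]
  congr 1; ext S; split_ifs <;> simp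

lemma occProj_mul_ann (x : Bool) {μ : Fin n} (h : μ ≠ 0) :
    (occProj x * ann μ : FockOp n) = ann μ * occProj x := by
  have h0 : (occProj false * ann μ : FockOp n) = ann μ * occProj false := by
    have h1 : (cre 0 * ann μ : FockOp n) = -(ann μ * cre 0) := by
      have := ann_mul_cre_add μ 0
      rw [if_neg h] at this
      exact eq_neg_of_add_eq_zero_right this
    simp only [occProj]
    rw [mul_assoc, h1, mul_neg, ← mul_assoc, ann_mul_ann, neg_mul, neg_neg, mul_assoc]
  cases x
  · exact h0
  · rw [occProj_true_eq, sub_mul, mul_sub, h0, one_mul, mul_one]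

lemma conjTranspose_occProj (x : Bool) : (occProj x : FockOp n)ᴴ = occProj x := by
  rw [occProj_eq_diagonal, diagonal_conjTranspose]
  congr 1; ext S; simp only [Pi.star_apply]; split_ifs <;> simp

lemma occProj_mul_cre (x : Bool) {μ : Fin n} (h : μ ≠ 0) :
    (occProj x * cre μ : FockOp n) = cre μ * occProj x := by
  have := congrArg conjTranspose (occProj_mul_ann x h)
  rw [conjTranspose_mul, conjTranspose_mul, conjTranspose_occProj] at this
  exact this.symm

lemma green_apply_zero_zero (ρ : FockOp n) : green ρ 0 0 = (ρ * occProj false).trace := by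
  simp [green, occProj, mul_assoc]

/-- The outcome probabilities are `(1 ± 𝓜₁₁) / 2`. -/
lemma IsNumberConservingGaussian.trace_occProj {ρ : FockOp n}
    (h : IsNumberConservingGaussian ρ) (x : Bool) :
    (occProj x * ρ * occProj x).trace = (1 + occSign x * corr ρ 0 0) / 2 := by
  rw [trace_mul_comm, ← mul_assoc, occProj_mul_self, trace_mul_comm, corr_eq_green]
  simp only [Matrix.sub_apply, Matrix.smul_apply, green_apply_zero_zero, one_apply_eq, smul_eq_mul]
  cases x
  · simp [occSign]
  · simp only [occSign, occProj_true_eq, mul_sub, mul_one, trace_sub, h.trace_eq_one]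
    push_cast; ring

lemma IsNumberConservingGaussian.outcomeProb_eq {ρ : FockOp n}
    (h : IsNumberConservingGaussian ρ) (x : Bool) :
    outcomeProb x ρ = (1 + occSign x * (corr ρ 0 0).re) / 2 := by
  rw [outcomeProb, h.trace_occProj, hermitian_apply_self h.isHermitian_corr]
  norm_cast

omit [NeZero n] in
lemma trace_cre_mul_ann (ρ : FockOp n) (hρ : ρ.trace = 1) (μ ν : Fin n) :
    (ρ * (cre ν * ann μ)).trace = (if μ = ν then 1 else 0) - green ρ μ ν := by
  rw [eq_sub_of_add_eq' (ann_mul_cre_add μ ν), mul_sub, trace_sub, green, of_apply, mul_assoc]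
  congr 1
  split_ifs <;> simp [hρ]

omit [NeZero n] in
lemma mul_anticomm_expand {R : Type*} [Ring R] {a b c d : R} (h : a * b = -(b * a)) :
    a * (c * b * d) + c * b * d * a = (a * c + c * a) * (b * d) + c * b * (a * d + d * a) := by
  have h1 : c * a * (b * d) = -(c * b * (a * d)) := by
    rw [mul_assoc, ← mul_assoc a, h]; noncomm_ring
  rw [add_mul, h1]
  noncomm_ring

/-- The unnormalized two-point function after the outcome "empty", by Wick's relation. -/
lemma IsNumberConservingGaussian.trace_empty {ρ : FockOp n}
    (h : IsNumberConservingGaussian ρ) {μ ν : Fin n} (hμ : μ ≠ 0) :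
    (ρ * (occProj false * (ann μ * cre ν))).trace =
      green ρ 0 0 * green ρ μ ν - green ρ μ 0 * green ρ 0 ν := by
  have h1 : (occProj false * (ann μ * cre ν) : FockOp n) = ann 0 * (cre 0 * ann μ * cre ν) := by
    simp only [occProj, mul_assoc]
  have h5 : ∀ κ : Fin n, (ρ * (ann κ * (cre 0 * ann μ * cre ν) +
      cre 0 * ann μ * cre ν * ann κ)).trace =
      (if κ = 0 then green ρ μ ν else 0) - if κ = ν then green ρ μ 0 else 0 := by
    intro κ
    have h6 := trace_cre_mul_ann ρ h.trace_eq_one μ 0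
    rw [if_neg hμ, zero_sub] at h6
    have e1 : (ρ * ((if κ = 0 then (1 : FockOp n) else 0) * (ann μ * cre ν))).trace =
        if κ = 0 then green ρ μ ν else 0 := by
      split_ifs
      · rw [one_mul, ← mul_assoc]; rfl
      · rw [zero_mul, mul_zero, trace_zero]
    have e2 : (ρ * (cre 0 * ann μ * (if κ = ν then (1 : FockOp n) else 0))).trace =
        -if κ = ν then green ρ μ 0 else 0 := by
      split_ifs
      · rw [mul_one, h6]
      · rw [mul_zero, mul_zero, trace_zero, neg_zero]
    rw [mul_anticomm_expand (ann_mul_ann κ μ), ann_mul_cre_add κ 0, ann_mul_cre_add κ ν, mul_add,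
      trace_add, e1, e2, sub_eq_add_neg]
  rw [h1, h.trace_ann_mul]
  simp only [h5, mul_sub, Finset.sum_sub_distrib]
  simp
  ring

/-- Away from the measured mode, `a_μ a_ν†` commutes with the projection. -/
lemma trace_projected (ρ : FockOp n) (x : Bool) {μ ν : Fin n} (hμ : μ ≠ 0) (hν : ν ≠ 0) :
    (occProj x * ρ * occProj x * ann μ * cre ν).trace =
      (ρ * (occProj x * (ann μ * cre ν))).trace := by
  rw [mul_assoc, mul_assoc, mul_assoc, trace_mul_comm]
  congr 1
  rw [mul_assoc, mul_assoc, mul_assoc, ← occProj_mul_cre x hν, ← mul_assoc (ann μ),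
    ← occProj_mul_ann x hμ, mul_assoc, ← mul_assoc (occProj x) (occProj x), occProj_mul_self]

lemma trace_projected_left_zero (ρ : FockOp n) (x : Bool) {ν : Fin n} (hν : ν ≠ 0) :
    (occProj x * ρ * occProj x * ann 0 * cre ν).trace = 0 := by
  have h1 : (ann 0 * ann 0 : FockOp n) = 0 := eq_zero_of_eq_neg (ann_mul_ann 0 0)
  rw [mul_assoc, mul_assoc, mul_assoc, trace_mul_comm]
  cases x
  · rw [mul_assoc, mul_assoc, mul_assoc, ← occProj_mul_cre _ hν]
    simp only [occProj, ← mul_assoc]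
    simp [mul_assoc _ (ann 0) (ann 0), h1]
  · simp only [occProj, ← mul_assoc]
    simp [mul_assoc _ (ann 0) (ann 0), h1]

lemma trace_projected_right_zero (ρ : FockOp n) (x : Bool) {μ : Fin n} (hμ : μ ≠ 0) :
    (occProj x * ρ * occProj x * ann μ * cre 0).trace = 0 := by
  have h1 : (cre 0 * cre 0 : FockOp n) = 0 := eq_zero_of_eq_neg (cre_mul_cre 0 0)
  cases x
  · rw [mul_assoc _ _ (ann μ), occProj_mul_ann _ hμ]
    simp only [occProj, ← mul_assoc]
    simp [mul_assoc _ (cre 0) (cre 0), h1]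
  · rw [trace_mul_comm]
    simp only [occProj, ← mul_assoc]
    simp [h1]

lemma trace_projected_zero_zero (ρ : FockOp n) (x : Bool) :
    (occProj x * ρ * occProj x * ann 0 * cre 0).trace =
      if x then 0 else (occProj x * ρ * occProj x).trace := by
  have h : (ann 0 * cre 0 : FockOp n) = occProj false := rfl
  rw [mul_assoc _ (ann 0), h, mul_assoc _ (occProj x)]
  cases x
  · rw [occProj_mul_self]; simp
  · rw [occProj_true_eq, sub_mul _ _ (occProj false), occProj_mul_self]
    simp

/-- The correlation matrix of the post-measurement state is a rank-one correction of the original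
one, followed by the replacement of the entry of the measured mode by `±1`. -/
lemma IsNumberConservingGaussian.corr_postState {ρ : FockOp n}
    (h : IsNumberConservingGaussian ρ) (x : Bool) (hp : outcomeProb x ρ ≠ 0) :
    corr (postState x ρ) = corr ρ -
      ((occSign x : ℂ) / (1 + occSign x * corr ρ 0 0)) •
        ((corr ρ + (occSign x : ℂ) • 1) * single 0 0 1 * (corr ρ + (occSign x : ℂ) • 1)) +
      (2 * (occSign x : ℂ)) • single 0 0 1 := by
  have hp1 : (outcomeProb x ρ : ℂ) = (1 + occSign x * corr ρ 0 0) / 2 := by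
    rw [h.outcomeProb_eq, hermitian_apply_self h.isHermitian_corr]; push_cast; simp
  have hne : 1 + occSign x * corr ρ 0 0 ≠ 0 := by
    intro h0
    rw [h0, zero_div] at hp1
    exact hp (by exact_mod_cast hp1)
  have hg : ∀ μ ν, corr (postState x ρ) μ ν = 2 * ((outcomeProb x ρ : ℂ)⁻¹ *
      (occProj x * ρ * occProj x * ann μ * cre ν).trace) - if μ = ν then 1 else 0 := by
    intro μ ν
    simp [corr, postState]
  have hs : (occSign x : ℂ) * occSign x = 1 := by exact_mod_cast occSign_mul_self x
  ext μ ν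
  have hE : ((corr ρ + (occSign x : ℂ) • 1) * single 0 0 1 *
      (corr ρ + (occSign x : ℂ) • 1) : Matrix (Fin n) (Fin n) ℂ) μ ν =
      (corr ρ + (occSign x : ℂ) • 1) μ 0 * (corr ρ + (occSign x : ℂ) • 1) 0 ν := by
    rw [mul_assoc, Matrix.mul_apply, Finset.sum_eq_single 0]
    · simp
    · intro b _ hb; simp [single_mul_apply_of_ne, hb]
    · simp
  rw [hg, hp1]
  simp only [Matrix.add_apply, Matrix.sub_apply, Matrix.smul_apply, hE, smul_eq_mul, one_apply,
    single_apply]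
  have hgr : ∀ μ ν, corr ρ μ ν = 2 * green ρ μ ν - if μ = ν then 1 else 0 := by
    intro μ ν; rw [corr_eq_green]; simp [one_apply]
  by_cases hμ : μ = 0 <;> by_cases hν : ν = 0
  · subst hμ; subst hν
    rw [trace_projected_zero_zero, h.trace_occProj]
    simp only [if_true, and_self]
    cases x
    · simp only [occSign, Complex.ofReal_one, one_mul] at hne ⊢
      simp
      field_simp
      ring
    · simp only [occSign, Complex.ofReal_neg, Complex.ofReal_one] at hne ⊢
      rw [neg_one_mul, ← sub_eq_add_neg] at hne
      simp [← sub_eq_add_neg]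
      field_simp
      ring
  · subst hμ
    rw [trace_projected_left_zero _ _ hν]
    simp only [if_true, Ne.symm hν, if_false, and_false]
    field_simp
    linear_combination corr ρ 0 ν * hs
  · subst hν
    rw [trace_projected_right_zero _ _ hμ]
    simp only [if_true, Ne.symm hμ, hμ, if_false, false_and]
    field_simp
    linear_combination corr ρ μ 0 * hs
  · rw [trace_projected _ _ hμ hν]
    simp only [Ne.symm hμ, hμ, Ne.symm hν, if_false, and_false]
    cases x
    · rw [h.trace_empty hμ]
      simp only [occSign, Complex.ofReal_one, one_mul] at hne ⊢
      field_simp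
      simp only [hgr, hμ, Ne.symm hν, if_false, if_true]
      split_ifs <;> ring
    · rw [occProj_true_eq, sub_mul, mul_sub, trace_sub, h.trace_empty hμ, one_mul,
        ← mul_assoc ρ]
      have : (ρ * ann μ * cre ν).trace = green ρ μ ν := rfl
      rw [this]
      simp only [occSign, Complex.ofReal_neg, Complex.ofReal_one, neg_one_mul,
        ← sub_eq_add_neg] at hne ⊢
      field_simp
      simp only [hgr, hμ, Ne.symm hν, if_false, if_true]
      split_ifs <;> ring

/-- The trace of the square of the updated matrix of `corr_postState`, for a sign `s` (`s² = 1`),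
in terms of the first diagonal entries of `M`, `M²` and `M³`. -/
lemma trace_sq_update (M : Matrix (Fin n) (Fin n) ℂ) (s : ℂ) (hs : s * s = 1)
    (hd : 1 + s * M 0 0 ≠ 0) :
    ((M - (s / (1 + s * M 0 0)) • ((M + s • 1) * single 0 0 1 * (M + s • 1)) +
        (2 * s) • single 0 0 1) *
      (M - (s / (1 + s * M 0 0)) • ((M + s • 1) * single 0 0 1 * (M + s • 1)) +
        (2 * s) • single 0 0 1)).trace =
      (M * M).trace + ((M * M) 0 0 + 1 + 2 * s * M 0 0) ^ 2 / (1 + s * M 0 0) ^ 2 -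
        2 * s * ((M * (M * M)) 0 0 + 2 * s * (M * M) 0 0 + M 0 0) / (1 + s * M 0 0) := by
  have h1 : ∀ A : Matrix (Fin n) (Fin n) ℂ, (single 0 0 1 * A).trace = A 0 0 := by
    intro A; simp [trace_single_mul]
  have h2 : ∀ A : Matrix (Fin n) (Fin n) ℂ, single 0 0 1 * A * single 0 0 1 =
      A 0 0 • single (0 : Fin n) (0 : Fin n) (1 : ℂ) := by
    intro A; simp [single_mul_mul_single]
  set E : Matrix (Fin n) (Fin n) ℂ := single 0 0 1 with hE
  set c := s / (1 + s * M 0 0) with hc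
  set N := M + s • 1 with hN
  have t1 : (M * (N * E * N)).trace = (N * M * N) 0 0 := by
    rw [← h1 (N * M * N), trace_mul_comm E, ← mul_assoc, trace_mul_comm _ N]
    simp only [mul_assoc]
  have t2 : (N * E * N * M).trace = (N * M * N) 0 0 := by rw [trace_mul_comm, t1]
  have t3 : (N * E * N * (N * E * N)).trace = (N * N) 0 0 * (N * N) 0 0 := by
    have : N * E * N * (N * E * N) = N * (E * (N * N) * E) * N := by simp only [mul_assoc]
    rw [this, h2, trace_mul_comm, ← mul_assoc, mul_smul_comm, trace_smul, trace_mul_comm, h1,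
      smul_eq_mul]
  have t4 : (N * E * N * E).trace = N 0 0 * N 0 0 := by
    rw [mul_assoc, mul_assoc, ← mul_assoc E, h2, mul_smul_comm, trace_smul, trace_mul_comm, h1,
      smul_eq_mul]
  have t5 : (E * (N * E * N)).trace = N 0 0 * N 0 0 := by rw [trace_mul_comm, t4]
  have t6 : (M * E).trace = M 0 0 := by rw [trace_mul_comm, h1]
  have t7 : (E * E).trace = 1 := by rw [h1, hE]; simp
  have n1 : N 0 0 = M 0 0 + s := by simp [hN]
  have n2 : (N * N) 0 0 = (M * M) 0 0 + 2 * s * M 0 0 + 1 := by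
    simp only [hN, add_mul, mul_add, smul_mul_assoc, mul_smul_comm, one_mul, mul_one,
      Matrix.add_apply, Matrix.smul_apply, smul_eq_mul, one_apply_eq]
    linear_combination hs
  have n3 : (N * M * N) 0 0 = (M * (M * M)) 0 0 + 2 * s * (M * M) 0 0 + M 0 0 := by
    simp only [hN, add_mul, mul_add, smul_mul_assoc, mul_smul_comm, one_mul, mul_one,
      Matrix.add_apply, Matrix.smul_apply, smul_eq_mul, mul_assoc]
    linear_combination M 0 0 * hs
  have e : (M - c • (N * E * N) + (2 * s) • E) * (M - c • (N * E * N) + (2 * s) • E) =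
      M * M - c • (M * (N * E * N)) + (2 * s) • (M * E) - c • (N * E * N * M) +
      (c * c) • (N * E * N * (N * E * N)) - (c * (2 * s)) • (N * E * N * E) + (2 * s) • (E * M)
      - (c * (2 * s)) • (E * (N * E * N)) + (4 : ℂ) • (E * E) := by
    have : (4 : ℂ) = 2 * s * (2 * s) := by linear_combination -4 * hs
    rw [this]
    simp only [add_mul, mul_add, sub_mul, mul_sub, smul_mul_assoc, mul_smul_comm]
    module
  rw [e]
  simp only [trace_add, trace_sub, trace_smul, smul_eq_mul, t1, t2, t3, t4, t5, t6, t7, h1, n1,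
    n2, n3]
  rw [hc]
  field_simp
  generalize M 0 0 = m
  generalize (M * M) 0 0 = q
  generalize (M * (M * M)) 0 0 = r
  have hs2 : s ^ 2 = 1 := by rw [sq, hs]
  have hs3 : s ^ 3 = s := by rw [pow_succ, hs2, one_mul]
  have hs4 : s ^ 4 = 1 := by rw [pow_succ, hs3, hs]
  have hs5 : s ^ 5 = s := by rw [pow_succ, hs4, one_mul]
  ring_nf
  simp only [hs2, hs3, hs4, hs5]
  ring

lemma IsNumberConservingGaussian.corr_zero_zero {ρ : FockOp n}
    (h : IsNumberConservingGaussian ρ) : corr ρ 0 0 = ((corr ρ 0 0).re : ℂ) :=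
  hermitian_apply_self h.isHermitian_corr 0

/-- `Tr 𝓜²` after the measurement. Weighted with the probability `(1 + σ 𝓜₁₁) / 2`, the term with
`(𝓜³)₁₁` is `-σ (𝓜³)₁₁`, so it cancels in the average over the outcomes. -/
lemma IsNumberConservingGaussian.re_trace_corr_postState {ρ : FockOp n}
    (h : IsNumberConservingGaussian ρ) (x : Bool) (hp : outcomeProb x ρ ≠ 0) :
    ((corr (postState x ρ) * corr (postState x ρ)).trace).re =
      ((corr ρ * corr ρ).trace).re +
        (((corr ρ * corr ρ) 0 0).re + 1 + 2 * occSign x * (corr ρ 0 0).re) ^ 2 /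
          (1 + occSign x * (corr ρ 0 0).re) ^ 2 -
        2 * occSign x * ((((corr ρ * (corr ρ * corr ρ)) 0 0).re +
          2 * occSign x * ((corr ρ * corr ρ) 0 0).re + (corr ρ 0 0).re)) /
          (1 + occSign x * (corr ρ 0 0).re) := by
  have hne : 1 + occSign x * (corr ρ 0 0).re ≠ 0 := by
    intro h0
    rw [h.outcomeProb_eq, h0, zero_div] at hp
    exact hp rfl
  have hm := h.corr_zero_zero
  have hq : (corr ρ * corr ρ) 0 0 = (((corr ρ * corr ρ) 0 0).re : ℂ) :=
    hermitian_apply_self (by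
      rw [IsHermitian, conjTranspose_mul, h.isHermitian_corr.eq]) 0
  have hneC : 1 + (occSign x : ℂ) * corr ρ 0 0 ≠ 0 := by
    rw [hm]; exact_mod_cast hne
  rw [h.corr_postState x hp, trace_sq_update _ _ (by exact_mod_cast occSign_mul_self x) hneC, hm,
    hq]
  generalize (corr ρ * corr ρ).trace = T
  generalize (corr ρ * (corr ρ * corr ρ)) 0 0 = r
  simp only [Complex.ofReal_re]
  generalize ((corr ρ * corr ρ) 0 0).re = q
  generalize (corr ρ 0 0).re = m
  generalize occSign x = s
  have e1 : (((q : ℂ) + 1 + 2 * s * m) ^ 2 / (1 + s * m) ^ 2) =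
      (((q + 1 + 2 * s * m) ^ 2 / (1 + s * m) ^ 2 : ℝ) : ℂ) := by push_cast; rfl
  have e2 : 2 * (s : ℂ) * (r + 2 * s * q + m) / (1 + s * m) =
      ((2 * s / (1 + s * m) : ℝ) : ℂ) * r + ((2 * s * (2 * s * q + m) / (1 + s * m) : ℝ) : ℂ) := by
    push_cast; ring
  rw [e1, e2]
  simp only [Complex.add_re, Complex.sub_re, Complex.ofReal_re, Complex.re_ofReal_mul]
  ring

lemma IsNumberConservingGaussian.sum_outcomeProb {ρ : FockOp n}
    (h : IsNumberConservingGaussian ρ) : ∑ x : Bool, outcomeProb x ρ = 1 := by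
  simp only [Fintype.sum_bool, h.outcomeProb_eq, occSign]
  ring

lemma IsNumberConservingGaussian.outcomeProb_nonneg {ρ : FockOp n}
    (h : IsNumberConservingGaussian ρ) (x : Bool) : 0 ≤ outcomeProb x ρ := by
  have h1 := (h.corr_re_sq_le 0).trans (h.corr_sq_apply_re_le_one 0)
  rw [sq_le_one_iff_abs_le_one, abs_le] at h1
  rw [h.outcomeProb_eq]
  cases x <;> simp only [occSign] <;> linarith [h1.1, h1.2]

/-- The change of the proxy entropy for a mode whose occupation is undetermined. -/
lemma IsNumberConservingGaussian.proxyChange_eq {ρ : FockOp n}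
    (h : IsNumberConservingGaussian ρ) (hm : (corr ρ 0 0).re ^ 2 ≠ 1) :
    proxyChange ρ = -(Real.log 2 / (1 - (corr ρ 0 0).re ^ 2)) *
      (1 - ((corr ρ * corr ρ) 0 0).re) ^ 2 := by
  have h1 : 1 + (corr ρ 0 0).re ≠ 0 := fun h0 => hm (by
    rw [eq_neg_of_add_eq_zero_right h0]; norm_num)
  have h2 : 1 - (corr ρ 0 0).re ≠ 0 := fun h0 => hm (by
    rw [← sub_eq_zero.1 h0]; norm_num)
  have h3 : 1 - (corr ρ 0 0).re ^ 2 ≠ 0 := sub_ne_zero.2 hm.symm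
  have hp1 : outcomeProb false ρ ≠ 0 := by
    rw [h.outcomeProb_eq]; simpa [occSign] using h1
  have hp2 : outcomeProb true ρ ≠ 0 := by
    rw [h.outcomeProb_eq]; simpa [occSign, ← sub_eq_add_neg] using h2
  rw [proxyChange, Fintype.sum_bool]
  simp only [proxyEntropy]
  rw [h.re_trace_corr_postState _ hp1, h.re_trace_corr_postState _ hp2, h.outcomeProb_eq,
    h.outcomeProb_eq]
  simp only [occSign, neg_one_mul, ← sub_eq_add_neg, one_mul]
  have h4 : 1 - (corr ρ 0 0).re ^ 2 = (1 - (corr ρ 0 0).re) * (1 + (corr ρ 0 0).re) := by ring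
  rw [h4]
  field_simp
  ring

lemma IsNumberConservingGaussian.corr_sq_zero_zero_of_sq_eq_one {ρ : FockOp n}
    (h : IsNumberConservingGaussian ρ) (hm : (corr ρ 0 0).re ^ 2 = 1) :
    ((corr ρ * corr ρ) 0 0).re = 1 :=
  le_antisymm (h.corr_sq_apply_re_le_one 0) (hm ▸ h.corr_re_sq_le 0)

/-- A mode with a determined occupation is uncorrelated with all others. -/
lemma IsNumberConservingGaussian.corr_zero_apply_of_sq_eq_one {ρ : FockOp n}
    (h : IsNumberConservingGaussian ρ) (hm : (corr ρ 0 0).re ^ 2 = 1) {ν : Fin n} (hν : ν ≠ 0) :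
    corr ρ 0 ν = 0 := by
  have h1 := h.sum_norm_corr_sq_le 0
  rw [← Finset.add_sum_erase _ _ (Finset.mem_univ (0 : Fin n)), h.corr_zero_zero,
    Complex.norm_real, Real.norm_eq_abs, sq_abs, hm] at h1
  have h2 := Finset.single_le_sum (f := fun ν => ‖corr ρ 0 ν‖ ^ 2)
    (fun _ _ => by positivity) (Finset.mem_erase.2 ⟨hν, Finset.mem_univ ν⟩)
  have h3 : ‖corr ρ 0 ν‖ ^ 2 ≤ 0 := by linarith
  exact norm_eq_zero.1 (pow_eq_zero_iff two_ne_zero |>.1 (le_antisymm h3 (by positivity)))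

lemma IsNumberConservingGaussian.proxyChange_eq_zero {ρ : FockOp n}
    (h : IsNumberConservingGaussian ρ) (hm : (corr ρ 0 0).re ^ 2 = 1) : proxyChange ρ = 0 := by
  have hq := h.corr_sq_zero_zero_of_sq_eq_one hm
  -- the first row of `𝓜` is `𝓜₁₁ e†`, so `(𝓜³)₁₁ = 𝓜₁₁ (𝓜²)₁₁`
  have hr : ((corr ρ * (corr ρ * corr ρ)) 0 0).re = (corr ρ 0 0).re := by
    rw [Matrix.mul_apply, Finset.sum_eq_single 0, h.corr_zero_zero, Complex.re_ofReal_mul, hq]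
    · simp
    · intro b _ hb; rw [h.corr_zero_apply_of_sq_eq_one hm hb, zero_mul]
    · simp
  rw [proxyChange, Fintype.sum_bool]
  rcases sq_eq_one_iff.1 hm with h1 | h1
  all_goals
    have e1 := h.outcomeProb_eq false
    have e2 := h.outcomeProb_eq true
    simp only [occSign, h1] at e1 e2
    norm_num at e1 e2
  · have := h.re_trace_corr_postState false (by rw [e1]; norm_num)
    simp only [proxyEntropy, this, e1, e2, hq, hr, h1, occSign]
    ring
  · have := h.re_trace_corr_postState true (by rw [e2]; norm_num)
    simp only [proxyEntropy, this, e1, e2, hq, hr, h1, occSign]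
    ring

/-- The decrease of the proxy entropy under a measurement is at least `log 2 (1 - (𝓜²)₁₁)²`, as
`1 / (1 - 𝓜₁₁²) ≥ 1`; if `𝓜₁₁² = 1`, both sides vanish. -/
lemma IsNumberConservingGaussian.le_neg_proxyChange {ρ : FockOp n}
    (h : IsNumberConservingGaussian ρ) :
    Real.log 2 * (1 - ((corr ρ * corr ρ) 0 0).re) ^ 2 ≤ -proxyChange ρ := by
  have hlog : 0 < Real.log 2 := Real.log_pos one_lt_two
  by_cases hm : (corr ρ 0 0).re ^ 2 = 1
  · rw [h.proxyChange_eq_zero hm, h.corr_sq_zero_zero_of_sq_eq_one hm]; simp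
  · rw [h.proxyChange_eq hm, neg_mul, neg_neg]
    refine mul_le_mul_of_nonneg_right ?_ (sq_nonneg _)
    have h1 := (h.corr_re_sq_le 0).trans (h.corr_sq_apply_re_le_one 0)
    rw [le_div_iff₀ (sub_pos.2 (lt_of_le_of_ne h1 hm))]
    nlinarith [sq_nonneg (corr ρ 0 0).re]

lemma IsNumberConservingGaussian.proxyChange_nonpos {ρ : FockOp n}
    (h : IsNumberConservingGaussian ρ) : proxyChange ρ ≤ 0 := by
  have h1 := h.le_neg_proxyChange
  have h2 : 0 ≤ Real.log 2 * (1 - ((corr ρ * corr ρ) 0 0).re) ^ 2 :=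
    mul_nonneg (Real.log_nonneg one_le_two) (sq_nonneg _)
  linarith

end Measurement

/-! ### The set of number-conserving Gaussian states -/

lemma continuous_fockUnitary :
    Continuous fun U : Matrix (Fin n) (Fin n) ℂ => fockUnitary U := by
  refine continuous_matrix fun S T => ?_
  refine Continuous.matrix_elem (continuous_list_prod _ fun μ _ => ?_) S ∅
  exact continuous_finsetSum _ fun ν _ =>
    (continuous_id.matrix_elem μ ν).smul continuous_const

lemma _root_.Continuous.conjState {X : Type*} [TopologicalSpace X]
    {f : X → Matrix (Fin n) (Fin n) ℂ} {g : X → FockOp n} (hf : Continuous f)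
    (hg : Continuous g) : Continuous fun x => conjState (f x) (g x) := by
  have h : Continuous fun x => fockUnitary (f x) := continuous_fockUnitary.comp hf
  exact (h.matrix_conjTranspose.matrix_mul hg).matrix_mul h

lemma continuous_occWeight (S : Finset (Fin n)) : Continuous fun lam => occWeight lam S := by
  refine continuous_finsetProd _ fun μ _ => ?_
  split_ifs <;> fun_prop

lemma continuous_productState :
    Continuous fun lam : Fin n → ℝ => (productState lam : FockOp n) := by
  simp only [productState_eq_diagonal]
  exact Continuous.matrix_diagonal (continuous_pi fun S =>
    Complex.continuous_ofReal.comp (continuous_occWeight S))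

/-- Gaussian states are the continuous image of `U(n) × [-1, 1]ⁿ`. -/
lemma isCompact_setOf_isNumberConservingGaussian :
    IsCompact {ρ : FockOp n | IsNumberConservingGaussian ρ} := by
  have hK : IsCompact ((Set.univ : Set (unitaryGroup (Fin n) ℂ)) ×ˢ
      (Set.univ.pi fun _ : Fin n => Set.Icc (-1 : ℝ) 1)) :=
    isCompact_univ.prod (isCompact_univ_pi fun _ => isCompact_Icc)
  have hc : Continuous fun q : unitaryGroup (Fin n) ℂ × (Fin n → ℝ) =>
      conjState (q.1 : Matrix (Fin n) (Fin n) ℂ) (productState q.2) :=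
    (continuous_subtype_val.comp continuous_fst).conjState
      (continuous_productState.comp continuous_snd)
  convert hK.image hc using 1
  ext ρ
  constructor
  · rintro ⟨U, lam, hl, rfl⟩
    exact ⟨(U, lam), ⟨trivial, fun μ _ => hl μ⟩, rfl⟩
  · rintro ⟨⟨U, lam⟩, ⟨-, hl⟩, rfl⟩
    exact ⟨U, lam, fun μ => hl μ trivial, rfl⟩

lemma isClosed_setOf_isNumberConservingGaussian :
    IsClosed {ρ : FockOp n | IsNumberConservingGaussian ρ} :=
  isCompact_setOf_isNumberConservingGaussian.isClosed

lemma conjState_conjState (U V : Matrix (Fin n) (Fin n) ℂ) (ρ : FockOp n) :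
    conjState V (conjState U ρ) = conjState (V * U) ρ := by
  simp only [conjState, ← fockUnitary_mul, conjTranspose_mul, mul_assoc]

lemma IsNumberConservingGaussian.conjState {ρ : FockOp n} (h : IsNumberConservingGaussian ρ)
    (V : unitaryGroup (Fin n) ℂ) :
    IsNumberConservingGaussian (conjState (V : Matrix (Fin n) (Fin n) ℂ) ρ) := by
  obtain ⟨U, lam, hl, rfl⟩ := h
  exact ⟨V * U, lam, hl, conjState_conjState _ _ _⟩

lemma conjState_smul (U : Matrix (Fin n) (Fin n) ℂ) (c : ℂ) (ρ : FockOp n) :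
    FreeFermion.conjState U (c • ρ) = c • FreeFermion.conjState U ρ := by
  simp [FreeFermion.conjState]

/-- The Gibbs weight `∏_μ d_μ ^ {n_μ}` is an unnormalized product state, with
`λ_μ = (1 - d_μ) / (1 + d_μ)`. -/
lemma fockUnitary_diagonal_eq_smul {d : Fin n → ℝ} (hd : ∀ μ, 0 < d μ) :
    fockUnitary (diagonal fun μ => (d μ : ℂ)) =
      ((∏ μ, (1 + d μ) : ℝ) : ℂ) • productState fun μ => (1 - d μ) / (1 + d μ) := by
  rw [fockUnitary_diagonal, productState_eq_diagonal, ← diagonal_smul]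
  congr 1; ext S
  simp only [Pi.smul_apply, smul_eq_mul, occWeight]
  rw [← Complex.ofReal_mul, ← Complex.ofReal_prod, ← Finset.prod_mul_distrib]
  congr 1
  rw [← Finset.prod_subset (Finset.subset_univ S) (f := fun μ => (1 + d μ) *
    if μ ∈ S then (1 - (1 - d μ) / (1 + d μ)) / 2 else (1 + (1 - d μ) / (1 + d μ)) / 2)]
  · refine Finset.prod_congr rfl fun μ hμ => ?_
    have := (hd μ)
    have h1 : 1 + d μ ≠ 0 := by positivity
    rw [if_pos hμ]
    field_simp
    ring
  · intro μ _ hμ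
    have := (hd μ)
    have h1 : 1 + d μ ≠ 0 := by positivity
    rw [if_neg hμ]
    field_simp
    ring

open scoped ComplexOrder in
/-- The second quantization of a positive definite matrix is an unnormalized Gaussian state. -/
lemma exists_fockUnitary_eq_smul {A : Matrix (Fin n) (Fin n) ℂ} (hA : A.PosDef) :
    ∃ (c : ℝ) (σ : FockOp n), 0 < c ∧ IsNumberConservingGaussian σ ∧
      fockUnitary A = (c : ℂ) • σ := by
  have hd := hA.eigenvalues_pos
  set d := hA.1.eigenvalues with hd'
  refine ⟨∏ μ, (1 + d μ), FreeFermion.conjState (hA.1.eigenvectorUnitary : Matrix _ _ ℂ)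
    (productState fun μ => (1 - d μ) / (1 + d μ)), Finset.prod_pos fun μ _ => ?_,
    ⟨_, _, fun μ => ?_, rfl⟩, ?_⟩
  · have := hd μ; positivity
  · have := hd μ
    rw [Set.mem_Icc, le_div_iff₀ (by positivity), div_le_iff₀ (by positivity)]
    constructor <;> linarith
  · rw [← conjState_smul, ← fockUnitary_diagonal_eq_smul hd]
    have h := hA.1.spectral_theorem
    rw [Unitary.conjStarAlgAut_apply, star_eq_conjTranspose] at h
    refine (congrArg fockUnitary h).trans ?_
    rw [FreeFermion.conjState, conjTranspose_fockUnitary, fockUnitary_mul, fockUnitary_mul,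
      mul_assoc]
    rfl

section Measurement

variable [NeZero n]

/-- The invertible approximation of the projection `occProj x`: the other eigenvalue `0` is
replaced by `ε`. -/
def softProj (x : Bool) (ε : ℝ) : FockOp n :=
  diagonal fun S => if decide ((0 : Fin n) ∈ S) = x then 1 else (ε : ℂ)

lemma softProj_zero (x : Bool) : (softProj x 0 : FockOp n) = occProj x := by
  rw [occProj_eq_diagonal, softProj, Complex.ofReal_zero]

lemma continuous_softProj (x : Bool) : Continuous fun ε => (softProj x ε : FockOp n) := by
  refine Continuous.matrix_diagonal (continuous_pi fun S => ?_)
  split_ifs <;> fun_prop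

lemma exists_softProj_eq_smul (x : Bool) {ε : ℝ} (hε : 0 < ε) :
    ∃ (k : ℝ) (e : Fin n → ℝ), 0 < k ∧ (∀ μ, 0 < e μ) ∧
      softProj x ε = (k : ℂ) • fockUnitary (diagonal fun μ => (e μ : ℂ)) := by
  have key : ∀ a : ℝ, fockUnitary (diagonal fun μ : Fin n => ((if μ = 0 then a else 1 : ℝ) : ℂ)) =
      diagonal fun S => if (0 : Fin n) ∈ S then (a : ℂ) else 1 := by
    intro a
    rw [fockUnitary_diagonal]
    congr 1; ext S
    rw [← Complex.ofReal_prod, Finset.prod_ite_eq']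
    split_ifs <;> simp
  have hpos : ∀ a : ℝ, 0 < a → ∀ μ : Fin n, 0 < (if μ = 0 then a else 1 : ℝ) := by
    intro a ha μ; split_ifs <;> simp [ha]
  cases x
  -- empty: weight `ε` for an occupied first mode; occupied: weight `ε⁻¹`, rescaled by `ε`
  · refine ⟨1, fun μ => if μ = 0 then ε else 1, one_pos, hpos ε hε, ?_⟩
    rw [key, Complex.ofReal_one, one_smul, softProj]
    congr 1; ext S
    by_cases h : (0 : Fin n) ∈ S <;> simp [h]
  · refine ⟨ε, fun μ => if μ = 0 then ε⁻¹ else 1, hε, hpos _ (inv_pos.2 hε), ?_⟩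
    rw [key, softProj, ← diagonal_smul]
    congr 1; ext S
    have : (ε : ℂ) ≠ 0 := by exact_mod_cast hε.ne'
    by_cases h : (0 : Fin n) ∈ S <;> simp [h, this]

open scoped ComplexOrder in
/-- Soft measurements of non-degenerate Gaussian states are unnormalized Gaussian states. -/
lemma exists_softProj_mul_eq_smul (x : Bool) {ε : ℝ} (hε : 0 < ε) (U : unitaryGroup (Fin n) ℂ)
    {lam : Fin n → ℝ} (hl : ∀ μ, lam μ ∈ Set.Ioo (-1 : ℝ) 1) :
    ∃ (c : ℝ) (σ : FockOp n), 0 < c ∧ IsNumberConservingGaussian σ ∧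
      softProj x ε * FreeFermion.conjState (U : Matrix (Fin n) (Fin n) ℂ) (productState lam) *
        softProj x ε = (c : ℂ) • σ := by
  obtain ⟨k, e, hk, he, hK⟩ := exists_softProj_eq_smul (n := n) x hε
  set d : Fin n → ℝ := fun μ => (1 - lam μ) / (1 + lam μ) with hd'
  have hd : ∀ μ, 0 < d μ := fun μ =>
    div_pos (by linarith [(hl μ).2]) (by linarith [(hl μ).1])
  have hlam : (fun μ => (1 - d μ) / (1 + d μ)) = lam := by
    ext μ
    have h1 : 1 + lam μ ≠ 0 := by linarith [(hl μ).1]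
    simp only [hd']
    field_simp
    ring
  have hD := fockUnitary_diagonal_eq_smul hd
  rw [hlam] at hD
  set p : ℝ := ∏ μ, (1 + d μ) with hp'
  have hp : 0 < p := Finset.prod_pos fun μ _ => by have := hd μ; positivity
  set E : Matrix (Fin n) (Fin n) ℂ := diagonal fun μ => (e μ : ℂ) with hE
  have hEh : Eᴴ = E := by
    rw [hE, diagonal_conjTranspose]; congr 1; ext; simp
  have hpd : ((E * (U : Matrix (Fin n) (Fin n) ℂ)) * (diagonal fun μ => (d μ : ℂ)) *
      (E * (U : Matrix (Fin n) (Fin n) ℂ))ᴴ).PosDef := by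
    have hu : IsUnit (E * (U : Matrix (Fin n) (Fin n) ℂ)) := by
      refine IsUnit.mul ?_ ?_
      · rw [isUnit_iff_isUnit_det, hE, det_diagonal, isUnit_iff_ne_zero]
        exact Finset.prod_ne_zero_iff.2 fun μ _ => by exact_mod_cast (he μ).ne'
      · exact IsUnit.of_mul_eq_one _ (mem_unitaryGroup_iff.1 U.2)
    rw [← star_eq_conjTranspose, hu.posDef_star_right_conjugate_iff, posDef_diagonal_iff]
    exact fun μ => by exact_mod_cast hd μ
  obtain ⟨c, σ, hc, hσ, h⟩ := exists_fockUnitary_eq_smul hpd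
  refine ⟨k * k * p⁻¹ * c, σ, by positivity, hσ, ?_⟩
  have hps : (productState lam : FockOp n) =
      ((p⁻¹ : ℝ) : ℂ) • fockUnitary (diagonal fun μ => (d μ : ℂ)) := by
    rw [hD, smul_smul, ← Complex.ofReal_mul, inv_mul_cancel₀ hp.ne', Complex.ofReal_one, one_smul]
  have h2 : fockUnitary E * ((fockUnitary (U : Matrix (Fin n) (Fin n) ℂ))ᴴ *
      fockUnitary (diagonal fun μ => (d μ : ℂ)) * fockUnitary (U : Matrix (Fin n) (Fin n) ℂ)) *
      fockUnitary E = (c : ℂ) • σ := by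
    rw [← h, conjTranspose_fockUnitary]
    simp only [fockUnitary_mul, conjTranspose_mul, hEh, mul_assoc]
  rw [hK, hps, conjState_smul, FreeFermion.conjState]
  simp only [smul_mul_assoc, mul_smul_comm, smul_smul]
  rw [h2, smul_smul]
  congr 1
  push_cast; ring

omit [NeZero n] in
lemma tendsto_inv_trace_smul {F : ℝ → FockOp n} (hF : Continuous F) (hne : (F 0).trace.re ≠ 0) :
    Filter.Tendsto (fun ε => (((F ε).trace.re : ℝ) : ℂ)⁻¹ • F ε)
      (nhdsWithin 0 (Set.Ioi 0)) (nhds ((((F 0).trace.re : ℝ) : ℂ)⁻¹ • F 0)) := by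
  have hc : Continuous fun ε => (((F ε).trace.re : ℝ) : ℂ) :=
    Complex.continuous_ofReal.comp (Complex.continuous_re.comp hF.matrix_trace)
  have hne' : (((F 0).trace.re : ℝ) : ℂ) ≠ 0 := Complex.ofReal_ne_zero.2 hne
  exact ((hc.continuousAt.inv₀ hne').smul hF.continuousAt).tendsto.mono_left nhdsWithin_le_nhds

/-- A post-measurement state is a limit of normalized soft measurements of non-degenerate Gaussian
states, and the set of Gaussian states is closed. -/
lemma IsNumberConservingGaussian.postState {ρ : FockOp n} (h : IsNumberConservingGaussian ρ)
    (x : Bool) (hp : outcomeProb x ρ ≠ 0) : IsNumberConservingGaussian (postState x ρ) := by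
  obtain ⟨U, lam, hl, rfl⟩ := h
  -- the factor `1 - ε` moves all `λ_μ` into the open interval
  set F : ℝ → FockOp n := fun ε => softProj x ε *
    FreeFermion.conjState (U : Matrix (Fin n) (Fin n) ℂ) (productState fun μ => (1 - ε) * lam μ) *
      softProj x ε with hF
  have hFc : Continuous F := by
    refine ((continuous_softProj x).matrix_mul ?_).matrix_mul (continuous_softProj x)
    have hl : Continuous fun ε : ℝ => fun μ => (1 - ε) * lam μ := by fun_prop
    exact continuous_const.conjState (continuous_productState.comp hl)
  have hF0 : F 0 = occProj x *
      FreeFermion.conjState (U : Matrix (Fin n) (Fin n) ℂ) (productState lam) * occProj x := by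
    simp [hF, softProj_zero]
  have hre : (F 0).trace.re = outcomeProb x
      (FreeFermion.conjState (U : Matrix (Fin n) (Fin n) ℂ) (productState lam)) := by
    rw [hF0, outcomeProb]
  have hlim := tendsto_inv_trace_smul hFc (hre ▸ hp)
  rw [hre, hF0] at hlim
  refine isClosed_setOf_isNumberConservingGaussian.mem_of_tendsto hlim ?_
  filter_upwards [Ioo_mem_nhdsGT (zero_lt_one (α := ℝ))] with ε hε
  obtain ⟨c, σ, hc, hσ, hFσ⟩ := exists_softProj_mul_eq_smul x hε.1 U
    (lam := fun μ => (1 - ε) * lam μ) (fun μ => by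
      obtain ⟨h1, h2⟩ := hl μ
      constructor <;> nlinarith [hε.1, hε.2])
  have hFe : F ε = (c : ℂ) • σ := hFσ
  have ht : (((F ε).trace.re : ℝ) : ℂ) = c := by
    rw [hFe, trace_smul, hσ.trace_eq_one]; simp
  have hcC : (c : ℂ) ≠ 0 := by exact_mod_cast hc.ne'
  rw [ht, hFe, smul_smul, inv_mul_cancel₀ hcC, one_smul]
  exact hσ

end Measurement

/-! ### Regularity of the observables -/

lemma continuous_corr : Continuous fun ρ : FockOp n => corr ρ := by
  refine continuous_matrix fun μ ν => ?_
  refine Continuous.sub (continuous_const.mul (Continuous.matrix_trace ?_)) continuous_const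
  exact (continuous_id.matrix_mul continuous_const).matrix_mul continuous_const

lemma continuous_corr_sq_re (μ : Fin n) :
    Continuous fun ρ : FockOp n => ((corr ρ * corr ρ) μ μ).re :=
  Complex.continuous_re.comp ((continuous_corr.matrix_mul continuous_corr).matrix_elem μ μ)

lemma continuous_proxyEntropy : Continuous (proxyEntropy : FockOp n → ℝ) :=
  continuous_const.mul (continuous_const.sub (Complex.continuous_re.comp
    (continuous_corr.matrix_mul continuous_corr).matrix_trace))

lemma continuous_proxyDensity : Continuous (proxyDensity : FockOp n → ℝ) :=
  continuous_proxyEntropy.div_const _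

lemma continuous_purity : Continuous (purity : FockOp n → ℝ) :=
  Complex.continuous_re.comp (continuous_id.matrix_mul continuous_id).matrix_trace

lemma proxyEntropy_conjState (U : unitaryGroup (Fin n) ℂ) (ρ : FockOp n) :
    proxyEntropy (conjState (U : Matrix (Fin n) (Fin n) ℂ) ρ) = proxyEntropy ρ := by
  have h := mem_unitaryGroup_iff'.1 (map_star_mem_unitaryGroup U)
  rw [star_eq_conjTranspose] at h
  rw [proxyEntropy, proxyEntropy, corr_conjState]
  set V := (U : Matrix (Fin n) (Fin n) ℂ).map star
  have h1 : V * corr ρ * Vᴴ * (V * corr ρ * Vᴴ) = V * (corr ρ * corr ρ * Vᴴ) := by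
    have : V * corr ρ * Vᴴ * (V * corr ρ * Vᴴ) = V * corr ρ * (Vᴴ * V) * (corr ρ * Vᴴ) := by
      simp only [mul_assoc]
    rw [this, h, mul_one]; simp only [mul_assoc]
  rw [h1, trace_mul_comm, mul_assoc, h, mul_one]

lemma purity_conjState (U : unitaryGroup (Fin n) ℂ) (ρ : FockOp n) :
    purity (conjState (U : Matrix (Fin n) (Fin n) ℂ) ρ) = purity ρ := by
  have h := fockUnitary_mul_conjTranspose U
  rw [purity, purity, trace_conjState_mul, conjState]
  set F := fockUnitary (U : Matrix (Fin n) (Fin n) ℂ)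
  have : F * (Fᴴ * ρ * F) * Fᴴ = F * Fᴴ * ρ * (F * Fᴴ) := by simp only [mul_assoc]
  rw [this, h, one_mul, mul_one]

lemma proxyEntropy_eq_sum (ρ : FockOp n) :
    proxyEntropy ρ = Real.log 2 * ∑ μ, (1 - ((corr ρ * corr ρ) μ μ).re) := by
  rw [proxyEntropy, trace, Complex.re_sum, Finset.sum_sub_distrib]
  simp

lemma proxyEntropy_productState (lam : Fin n → ℝ) :
    proxyEntropy (productState lam) = Real.log 2 * ∑ μ, (1 - lam μ ^ 2) := by
  rw [proxyEntropy_eq_sum, corr_productState, diagonal_mul_diagonal]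
  congr 1
  refine Finset.sum_congr rfl fun μ _ => ?_
  rw [diagonal_apply_eq, ← Complex.ofReal_mul, Complex.ofReal_re, sq]

lemma purity_productState (lam : Fin n → ℝ) :
    purity (productState lam) = ∏ μ, (1 + lam μ ^ 2) / 2 := by
  rw [purity, productState_eq_diagonal, diagonal_mul_diagonal, trace_diagonal]
  have h : ∀ S, (occWeight lam S : ℂ) * occWeight lam S = ((occWeight lam S ^ 2 : ℝ) : ℂ) := by
    intro S; push_cast; ring
  simp only [h]
  rw [← Complex.ofReal_sum, Complex.ofReal_re, sum_occWeight_pow]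
  exact Finset.prod_congr rfl fun μ _ => by ring

lemma proxyEntropy_nonneg {ρ : FockOp n} (h : IsNumberConservingGaussian ρ) :
    0 ≤ proxyEntropy ρ := by
  rw [proxyEntropy_eq_sum]
  exact mul_nonneg (Real.log_nonneg one_le_two) (Finset.sum_nonneg fun μ _ =>
    sub_nonneg.2 (h.corr_sq_apply_re_le_one μ))

lemma proxyEntropy_le {ρ : FockOp n} (h : IsNumberConservingGaussian ρ) :
    proxyEntropy ρ ≤ n * Real.log 2 := by
  rw [proxyEntropy_eq_sum, mul_comm]
  refine mul_le_mul_of_nonneg_right ?_ (Real.log_nonneg one_le_two)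
  refine (Finset.sum_le_card_nsmul _ _ 1 fun μ _ => ?_).trans (by simp)
  rw [sub_le_self_iff, hermitian_sq_apply_re h.isHermitian_corr]
  positivity

/-- The proxy entropy bounds the second Rényi entropy from above: mode by mode this is the
inequality `2 ^ y ≤ 1 + y` for `y = λ_μ²` in `[0, 1]`. -/
lemma exp_neg_proxyEntropy_le_purity {ρ : FockOp n} (h : IsNumberConservingGaussian ρ) :
    Real.exp (-proxyEntropy ρ) ≤ purity ρ := by
  obtain ⟨U, lam, hl, rfl⟩ := h
  rw [proxyEntropy_conjState, purity_conjState, proxyEntropy_productState, purity_productState,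
    Finset.mul_sum, ← Finset.sum_neg_distrib, Real.exp_sum]
  refine Finset.prod_le_prod (fun _ _ => (Real.exp_pos _).le) fun μ _ => ?_
  obtain ⟨h1, h2⟩ := hl μ
  have h3 := rpow_one_add_le_one_add_mul_self (s := (1 : ℝ)) (by norm_num) (sq_nonneg (lam μ))
    (by nlinarith : lam μ ^ 2 ≤ 1)
  have h4 : Real.exp (-(Real.log 2 * (1 - lam μ ^ 2))) = (1 + 1) ^ (lam μ ^ 2) / 2 := by
    rw [one_add_one_eq_two, Real.rpow_def_of_pos two_pos, eq_div_iff two_ne_zero]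
    nth_rewrite 2 [← Real.exp_log two_pos]
    rw [← Real.exp_add]
    congr 1; ring
  rw [h4]
  rw [mul_one] at h3
  exact div_le_div_of_nonneg_right h3 zero_le_two

/-! ### Ensembles -/

instance : SecondCountableTopology (FockOp n) :=
  inferInstanceAs (SecondCountableTopology (Finset (Fin n) → Finset (Fin n) → ℂ))

/-- A continuous observable is bounded on the compact set of Gaussian states. -/
lemma integrable_of_continuous {P : Measure (FockOp n)} [IsFiniteMeasure P]
    (hP : ∀ᵐ ρ ∂P, IsNumberConservingGaussian ρ) {f : FockOp n → ℝ} (hf : Continuous f) :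
    Integrable f P := by
  obtain ⟨C, hC⟩ := isCompact_setOf_isNumberConservingGaussian.exists_bound_of_continuousOn
    (hf.continuousOn (s := {ρ : FockOp n | IsNumberConservingGaussian ρ}))
  exact Integrable.of_bound hf.measurable.aestronglyMeasurable C (hP.mono fun ρ hρ => hC ρ hρ)

lemma measurableSet_isNumberConservingGaussian :
    MeasurableSet {ρ : FockOp n | IsNumberConservingGaussian ρ} :=
  isClosed_setOf_isNumberConservingGaussian.measurableSet

section MeasureStep

variable [NeZero n]

lemma continuous_outcomeProb (x : Bool) : Continuous (outcomeProb x : FockOp n → ℝ) :=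
  Complex.continuous_re.comp
    ((continuous_const.matrix_mul continuous_id).matrix_mul continuous_const).matrix_trace

lemma measurable_ofReal_outcomeProb (x : Bool) :
    Measurable fun ρ : FockOp n => ENNReal.ofReal (outcomeProb x ρ) :=
  (continuous_outcomeProb x).measurable.ennreal_ofReal

lemma measurable_postState (x : Bool) : Measurable (postState x : FockOp n → FockOp n) := by
  have h1 : Continuous fun q : ℂ × FockOp n => q.1 • (occProj x * q.2 * occProj x) :=
    continuous_fst.smul ((continuous_const.matrix_mul continuous_snd).matrix_mul continuous_const)
  have h2 : Measurable fun ρ : FockOp n => ((outcomeProb x ρ : ℂ))⁻¹ :=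
    (Complex.measurable_ofReal.comp (continuous_outcomeProb x).measurable).inv
  exact h1.measurable.comp (h2.prodMk measurable_id)

variable {P : Measure (FockOp n)} [IsProbabilityMeasure P]

lemma isProbabilityMeasure_measureStep (hP : ∀ᵐ ρ ∂P, IsNumberConservingGaussian ρ) :
    IsProbabilityMeasure (measureStep P) := by
  constructor
  rw [measureStep, Measure.finsetSum_apply]
  simp only [Measure.map_apply (measurable_postState _) MeasurableSet.univ, Set.preimage_univ,
    withDensity_apply _ MeasurableSet.univ, Measure.restrict_univ]
  rw [← lintegral_finsetSum _ fun x _ => measurable_ofReal_outcomeProb x]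
  rw [lintegral_congr_ae (g := fun _ => 1)]
  · simp
  · filter_upwards [hP] with ρ hρ
    rw [← ENNReal.ofReal_sum_of_nonneg fun x _ => hρ.outcomeProb_nonneg x, hρ.sum_outcomeProb,
      ENNReal.ofReal_one]

omit [IsProbabilityMeasure P] in
lemma ae_measureStep (hP : ∀ᵐ ρ ∂P, IsNumberConservingGaussian ρ) :
    ∀ᵐ ρ ∂(measureStep P), IsNumberConservingGaussian ρ := by
  rw [measureStep, ae_finsetSum_measure_iff]
  intro x _
  rw [ae_map_iff (measurable_postState x).aemeasurable measurableSet_isNumberConservingGaussian,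
    ae_withDensity_iff (measurable_ofReal_outcomeProb x)]
  filter_upwards [hP] with ρ hρ h0
  exact hρ.postState x fun h => h0 (by rw [h, ENNReal.ofReal_zero])

lemma integral_measureStep (hP : ∀ᵐ ρ ∂P, IsNumberConservingGaussian ρ) {f : FockOp n → ℝ}
    (hf : Continuous f) :
    ∫ ρ, f ρ ∂(measureStep P) = ∑ x : Bool, ∫ ρ, outcomeProb x ρ * f (postState x ρ) ∂P := by
  have := isProbabilityMeasure_measureStep hP
  have hint := integrable_of_continuous (ae_measureStep hP) hf
  have hle : ∀ x, ((P.withDensity fun ρ => ENNReal.ofReal (outcomeProb x ρ)).map (postState x)) ≤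
      measureStep P := fun x => by
    rw [measureStep]
    exact Finset.single_le_sum (f := fun x => ((P.withDensity fun ρ =>
      ENNReal.ofReal (outcomeProb x ρ)).map (postState x)))
      (fun _ _ => Measure.zero_le _) (Finset.mem_univ x)
  rw [measureStep, integral_finsetSum_measure fun x _ => hint.mono_measure (hle x)]
  refine Finset.sum_congr rfl fun x _ => ?_
  rw [integral_map (measurable_postState x).aemeasurable hf.measurable.aestronglyMeasurable,
    integral_withDensity_eq_integral_toReal_smul (measurable_ofReal_outcomeProb x)
      (by simp)]
  refine integral_congr_ae ?_
  filter_upwards [hP] with ρ hρ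
  rw [ENNReal.toReal_ofReal (hρ.outcomeProb_nonneg x), smul_eq_mul]

lemma integrable_outcomeProb_mul (hP : ∀ᵐ ρ ∂P, IsNumberConservingGaussian ρ) {f : FockOp n → ℝ}
    (hf : Continuous f) (x : Bool) :
    Integrable (fun ρ => outcomeProb x ρ * f (postState x ρ)) P := by
  obtain ⟨C, hC⟩ := isCompact_setOf_isNumberConservingGaussian.exists_bound_of_continuousOn
    (hf.continuousOn (s := {ρ : FockOp n | IsNumberConservingGaussian ρ}))
  refine Integrable.of_bound (((continuous_outcomeProb x).measurable.mul
    (hf.measurable.comp (measurable_postState x))).aestronglyMeasurable) |C| ?_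
  filter_upwards [hP] with ρ hρ
  -- for an outcome of probability zero `postState` is a junk value, which has weight zero
  by_cases h0 : outcomeProb x ρ = 0
  · simp [h0]
  have h1 := hρ.outcomeProb_nonneg x
  have h2 : outcomeProb x ρ ≤ 1 := by
    rw [← hρ.sum_outcomeProb]
    exact Finset.single_le_sum (f := fun x => outcomeProb x ρ)
      (fun y _ => hρ.outcomeProb_nonneg y) (Finset.mem_univ x)
  rw [norm_mul, Real.norm_of_nonneg h1]
  exact (mul_le_of_le_one_left (norm_nonneg _) h2).trans
    ((hC _ (hρ.postState x h0)).trans (le_abs_self C))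

lemma integrable_proxyChange (hP : ∀ᵐ ρ ∂P, IsNumberConservingGaussian ρ) :
    Integrable proxyChange P :=
  (integrable_finsetSum _ fun x _ =>
    integrable_outcomeProb_mul hP continuous_proxyEntropy x).sub
      (integrable_of_continuous hP continuous_proxyEntropy)

lemma integral_measureStep_sub (hP : ∀ᵐ ρ ∂P, IsNumberConservingGaussian ρ) :
    (∫ ρ, proxyEntropy ρ ∂(measureStep P)) - ∫ ρ, proxyEntropy ρ ∂P =
      ∫ ρ, proxyChange ρ ∂P := by
  have h := integrable_outcomeProb_mul hP continuous_proxyEntropy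
  rw [integral_measureStep hP continuous_proxyEntropy, ← integral_finsetSum _ fun x _ => h x,
    ← integral_sub (integrable_finsetSum _ fun x _ => h x)
      (integrable_of_continuous hP continuous_proxyEntropy)]
  rfl

/-- The average decrease of the proxy entropy under a measurement. -/
lemma integral_measureStep_sub_le (hP : ∀ᵐ ρ ∂P, IsNumberConservingGaussian ρ) :
    (∫ ρ, proxyEntropy ρ ∂(measureStep P)) - ∫ ρ, proxyEntropy ρ ∂P ≤
      -(Real.log 2 * ∫ ρ, (1 - ((corr ρ * corr ρ) 0 0).re) ^ 2 ∂P) := by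
  rw [integral_measureStep_sub hP, ← integral_const_mul, ← integral_neg]
  refine integral_mono_ae (integrable_proxyChange hP)
    ((integrable_of_continuous hP
      ((continuous_const.sub (continuous_corr_sq_re 0)).pow 2)).const_mul _).neg ?_
  filter_upwards [hP] with ρ hρ
  have := hρ.le_neg_proxyChange
  exact le_neg_of_le_neg this

lemma sq_integral_le (hP : ∀ᵐ ρ ∂P, IsNumberConservingGaussian ρ) :
    (∫ ρ, (1 - ((corr ρ * corr ρ) 0 0).re) ∂P) ^ 2 ≤
      ∫ ρ, (1 - ((corr ρ * corr ρ) 0 0).re) ^ 2 ∂P := by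
  have hc : Continuous fun ρ : FockOp n => 1 - ((corr ρ * corr ρ) 0 0).re :=
    continuous_const.sub (continuous_corr_sq_re 0)
  exact (even_two.convexOn_pow (𝕜 := ℝ)).map_integral_le (continuous_pow 2).continuousOn
    isClosed_univ (by simp) (integrable_of_continuous hP hc)
    (integrable_of_continuous hP (hc.pow 2))

end MeasureStep

/-! ### Averaging over Haar-random unitaries -/

instance : IsProbabilityMeasure (haarUnitary n) :=
  ⟨Measure.haarMeasure_self (K₀ := ⊤)⟩

instance : (haarUnitary n).IsMulLeftInvariant := by
  unfold haarUnitary; infer_instance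

section UnitaryStep

variable {P : Measure (FockOp n)} [IsProbabilityMeasure P]

lemma measurable_conjState_prod :
    Measurable fun q : unitaryGroup (Fin n) ℂ × FockOp n =>
      conjState (q.1 : Matrix (Fin n) (Fin n) ℂ) q.2 :=
  ((continuous_subtype_val.comp continuous_fst).conjState continuous_snd).measurable

instance isProbabilityMeasure_unitaryStep : IsProbabilityMeasure (unitaryStep P) :=
  Measure.isProbabilityMeasure_map measurable_conjState_prod.aemeasurable

omit [IsProbabilityMeasure P] in
lemma ae_unitaryStep (hP : ∀ᵐ ρ ∂P, IsNumberConservingGaussian ρ) :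
    ∀ᵐ ρ ∂(unitaryStep P), IsNumberConservingGaussian ρ := by
  rw [unitaryStep, ae_map_iff measurable_conjState_prod.aemeasurable
    measurableSet_isNumberConservingGaussian]
  have h : ∀ᵐ q ∂((haarUnitary n).prod P), IsNumberConservingGaussian q.2 :=
    Measure.quasiMeasurePreserving_snd.ae hP
  exact h.mono fun q hq => hq.conjState q.1

lemma integral_proxyEntropy_unitaryStep :
    ∫ ρ, proxyEntropy ρ ∂(unitaryStep P) = ∫ ρ, proxyEntropy ρ ∂P := by
  rw [unitaryStep, integral_map measurable_conjState_prod.aemeasurable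
    continuous_proxyEntropy.measurable.aestronglyMeasurable]
  simp only [proxyEntropy_conjState]
  rw [integral_fun_snd]
  simp

/-- After a Haar-random unitary the ensemble is invariant under every further unitary. -/
lemma map_conjState_unitaryStep (W : unitaryGroup (Fin n) ℂ) :
    (unitaryStep P).map (conjState (W : Matrix (Fin n) (Fin n) ℂ)) = unitaryStep P := by
  have hW : Measurable (conjState (W : Matrix (Fin n) (Fin n) ℂ)) :=
    (continuous_const.conjState continuous_id).measurable
  have hm : Measurable fun U : unitaryGroup (Fin n) ℂ => W * U :=
    (continuous_const_mul W).measurable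
  have hcomp : conjState (W : Matrix (Fin n) (Fin n) ℂ) ∘
      (fun q : unitaryGroup (Fin n) ℂ × FockOp n =>
        conjState (q.1 : Matrix (Fin n) (Fin n) ℂ) q.2) =
      (fun q : unitaryGroup (Fin n) ℂ × FockOp n =>
        conjState (q.1 : Matrix (Fin n) (Fin n) ℂ) q.2) ∘ Prod.map (fun U => W * U) id := by
    funext q
    simp only [Function.comp_apply, Prod.map_fst, Prod.map_snd, id, Submonoid.coe_mul,
      conjState_conjState]
  have h1 : (haarUnitary n).prod P =
      ((haarUnitary n).prod P).map (Prod.map (fun U => W * U) id) := by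
    rw [← Measure.map_prod_map _ _ hm measurable_id, map_mul_left_eq_self, Measure.map_id]
  unfold unitaryStep
  conv_rhs => rw [h1]
  rw [Measure.map_map hW measurable_conjState_prod,
    Measure.map_map measurable_conjState_prod (hm.prodMap measurable_id), hcomp]

lemma permMatrix_mem_unitaryGroup (σ : Equiv.Perm (Fin n)) :
    σ.permMatrix ℂ ∈ unitaryGroup (Fin n) ℂ := by
  rw [mem_unitaryGroup_iff, star_eq_conjTranspose, conjTranspose_permMatrix, ← permMatrix_mul]
  simp

lemma corr_sq_conjState_perm (σ : Equiv.Perm (Fin n)) (ρ : FockOp n) (μ : Fin n) :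
    (corr (conjState (σ.permMatrix ℂ) ρ) * corr (conjState (σ.permMatrix ℂ) ρ)) μ μ =
      (corr ρ * corr ρ) (σ μ) (σ μ) := by
  have h1 : (σ.permMatrix ℂ).map star = σ.permMatrix ℂ := by
    ext i j
    simp [Equiv.Perm.permMatrix, PEquiv.toMatrix_apply, apply_ite]
  have h2 : corr (conjState (σ.permMatrix ℂ) ρ) = (corr ρ).submatrix σ σ := by
    have := corr_conjState ⟨_, permMatrix_mem_unitaryGroup σ⟩ ρ
    simp only [h1] at this
    rw [this]
    ext i j
    simp [conjTranspose_permMatrix, Equiv.Perm.permMatrix, PEquiv.toMatrix_toPEquiv_mul,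
      PEquiv.mul_toMatrix_toPEquiv]
    rfl
  rw [h2, submatrix_mul_equiv]
  rfl

variable [NeZero n]

/-- By Haar invariance all modes are equivalent, so a single mode carries the average density. -/
lemma integral_one_sub_unitaryStep (hP : ∀ᵐ ρ ∂P, IsNumberConservingGaussian ρ) :
    ∫ ρ, (1 - ((corr ρ * corr ρ) 0 0).re) ∂(unitaryStep P) = ∫ ρ, proxyDensity ρ ∂P := by
  have hc : ∀ μ, Continuous fun ρ : FockOp n => 1 - ((corr ρ * corr ρ) μ μ).re :=
    fun μ => continuous_const.sub (continuous_corr_sq_re μ)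
  have hperm : ∀ μ : Fin n, ∫ ρ, (1 - ((corr ρ * corr ρ) μ μ).re) ∂(unitaryStep P) =
      ∫ ρ, (1 - ((corr ρ * corr ρ) 0 0).re) ∂(unitaryStep P) := by
    intro μ
    -- exchange the modes `0` and `μ`
    set σ : Equiv.Perm (Fin n) := Equiv.swap 0 μ with hσ
    conv_rhs => rw [← map_conjState_unitaryStep ⟨_, permMatrix_mem_unitaryGroup σ⟩]
    have hm : Measurable (conjState (σ.permMatrix ℂ) : FockOp n → FockOp n) :=
      (continuous_const.conjState continuous_id).measurable
    rw [integral_map hm.aemeasurable (hc 0).measurable.aestronglyMeasurable]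
    simp only [corr_sq_conjState_perm, hσ, Equiv.swap_apply_left]
  have hn : (n : ℝ) ≠ 0 := Nat.cast_ne_zero.2 (NeZero.ne n)
  have hlog : Real.log 2 ≠ 0 := (Real.log_pos one_lt_two).ne'
  have h1 : ∫ ρ, proxyEntropy ρ ∂(unitaryStep P) =
      Real.log 2 * (n * ∫ ρ, (1 - ((corr ρ * corr ρ) 0 0).re) ∂(unitaryStep P)) := by
    simp only [proxyEntropy_eq_sum]
    rw [integral_const_mul, integral_finsetSum _ fun μ _ =>
      integrable_of_continuous (ae_unitaryStep hP) (hc μ)]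
    simp only [hperm]
    simp
  simp only [proxyDensity]
  rw [integral_div, ← integral_proxyEntropy_unitaryStep, h1]
  field_simp

/-- One step of the circuit decreases the average density `s` by at least `s² / n`. -/
lemma integral_proxyDensity_step (hP : ∀ᵐ ρ ∂P, IsNumberConservingGaussian ρ) :
    (∫ ρ, proxyDensity ρ ∂(measureStep (unitaryStep P))) ≤
      (∫ ρ, proxyDensity ρ ∂P) - 1 / n * (∫ ρ, proxyDensity ρ ∂P) ^ 2 := by
  have hU := ae_unitaryStep hP
  have h1 := integral_measureStep_sub_le hU
  have h2 := sq_integral_le hU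
  rw [integral_one_sub_unitaryStep hP] at h2
  rw [integral_proxyEntropy_unitaryStep] at h1
  have hlog : 0 < Real.log 2 := Real.log_pos one_lt_two
  have hn : 0 < (n : ℝ) := Nat.cast_pos.2 (NeZero.pos n)
  have h3 := h1.trans (neg_le_neg (mul_le_mul_of_nonneg_left h2 hlog.le))
  have h4 : ∀ Q : Measure (FockOp n),
      ∫ ρ, proxyEntropy ρ ∂Q = (n * Real.log 2) * ∫ ρ, proxyDensity ρ ∂Q := by
    intro Q
    simp only [proxyDensity]
    rw [integral_div]; field_simp
  rw [h4, h4] at h3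
  have h5 : 0 < n * Real.log 2 := by positivity
  rw [← sub_nonneg] at h3 ⊢
  have : (∫ ρ, proxyDensity ρ ∂P) - 1 / n * (∫ ρ, proxyDensity ρ ∂P) ^ 2 -
      (∫ ρ, proxyDensity ρ ∂(measureStep (unitaryStep P))) = (n * Real.log 2)⁻¹ *
      (-(Real.log 2 * (∫ ρ, proxyDensity ρ ∂P) ^ 2) -
        (n * Real.log 2 * ∫ ρ, proxyDensity ρ ∂(measureStep (unitaryStep P)) -
          n * Real.log 2 * ∫ ρ, proxyDensity ρ ∂P)) := by
    field_simp
    ring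
  rw [this]
  positivity

end UnitaryStep

/-! ### The circuit -/

section Circuit

variable [NeZero n] {P : Measure (FockOp n)} [IsProbabilityMeasure P]

lemma evolve_succ (P : Measure (FockOp n)) (t : ℕ) :
    evolve P (t + 1) = measureStep (unitaryStep (evolve P t)) :=
  Function.iterate_succ_apply' _ _ _

/-- At every time the ensemble is a probability measure on Gaussian states. -/
lemma evolve_spec (hP : ∀ᵐ ρ ∂P, IsNumberConservingGaussian ρ) (t : ℕ) :
    IsProbabilityMeasure (evolve P t) ∧ ∀ᵐ ρ ∂(evolve P t), IsNumberConservingGaussian ρ := by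
  induction t with
  | zero => exact ⟨‹_›, hP⟩
  | succ t ih =>
    have := ih.1
    rw [evolve_succ]
    exact ⟨isProbabilityMeasure_measureStep (ae_unitaryStep ih.2),
      ae_measureStep (ae_unitaryStep ih.2)⟩

lemma integral_proxyDensity_evolve_succ_le (hP : ∀ᵐ ρ ∂P, IsNumberConservingGaussian ρ) (t : ℕ) :
    (∫ ρ, proxyDensity ρ ∂(evolve P (t + 1))) ≤ (∫ ρ, proxyDensity ρ ∂(evolve P t)) -
      1 / n * (∫ ρ, proxyDensity ρ ∂(evolve P t)) ^ 2 := by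
  obtain ⟨_, h⟩ := evolve_spec hP t
  rw [evolve_succ]
  exact integral_proxyDensity_step h

omit [NeZero n] [IsProbabilityMeasure P] in
lemma integral_proxyDensity_nonneg (hP : ∀ᵐ ρ ∂P, IsNumberConservingGaussian ρ) :
    0 ≤ ∫ ρ, proxyDensity ρ ∂P := by
  refine integral_nonneg_of_ae ?_
  filter_upwards [hP] with ρ hρ
  exact div_nonneg (proxyEntropy_nonneg hρ)
    (mul_nonneg (Nat.cast_nonneg n) (Real.log_nonneg one_le_two))

omit [NeZero n] in
lemma integral_proxyDensity_le_one (hP : ∀ᵐ ρ ∂P, IsNumberConservingGaussian ρ) :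
    ∫ ρ, proxyDensity ρ ∂P ≤ 1 := by
  have h : ∫ ρ, proxyDensity ρ ∂P ≤ ∫ _, (1 : ℝ) ∂P := by
    refine integral_mono_ae (integrable_of_continuous hP continuous_proxyDensity)
      (integrable_const _) ?_
    filter_upwards [hP] with ρ hρ
    exact div_le_one_of_le₀ (proxyEntropy_le hρ)
      (mul_nonneg (Nat.cast_nonneg n) (Real.log_nonneg one_le_two))
  simpa using h

/-- The recursion `s' ≤ s - s² / n` forces `s` to decay like `(1 + t / n)⁻¹`. -/
lemma le_inv_of_step_le {n : ℝ} (hn : 0 < n) {s : ℕ → ℝ} (h0 : s 0 ≤ 1) (hs : ∀ t, 0 ≤ s t)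
    (hstep : ∀ t, s (t + 1) ≤ s t - 1 / n * s t ^ 2) (t : ℕ) : s t ≤ (1 + t / n)⁻¹ := by
  have key : ∀ t : ℕ, s t * (n + t) ≤ n := by
    intro t
    induction t with
    | zero => simpa using mul_le_mul_of_nonneg_right h0 hn.le
    | succ t ih =>
      -- `1 - x ≤ 1 / (1 + x)` turns the step into one that is monotone in `s t`
      have h1 : s (t + 1) * (n + s t) ≤ s t * n := by
        have h2 : s (t + 1) * (n + s t) ≤ (s t - 1 / n * s t ^ 2) * (n + s t) :=
          mul_le_mul_of_nonneg_right (hstep t) (by linarith [hs t])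
        have h3 : (s t - 1 / n * s t ^ 2) * (n + s t) = s t * n - s t ^ 3 / n := by
          field_simp; ring
        have h4 : 0 ≤ s t ^ 3 / n := div_nonneg (pow_nonneg (hs t) 3) hn.le
        linarith
      have h5 : 0 < n + s t := by linarith [hs t]
      refine le_of_mul_le_mul_right ?_ h5
      have h6 := mul_le_mul_of_nonneg_right h1
        (by positivity : (0 : ℝ) ≤ n + ((t + 1 : ℕ) : ℝ))
      have h7 : s t * (n + ((t + 1 : ℕ) : ℝ)) ≤ n + s t := by push_cast; linarith
      nlinarith [mul_le_mul_of_nonneg_left h7 hn.le]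
  have hpos : 0 < 1 + (t : ℝ) / n := by positivity
  rw [← one_div, le_div_iff₀ hpos]
  refine le_of_mul_le_mul_right ?_ hn
  have h8 : s t * (1 + t / n) * n = s t * (n + t) := by field_simp
  rw [h8, one_mul]
  exact key t

lemma integral_proxyDensity_evolve_le (hP : ∀ᵐ ρ ∂P, IsNumberConservingGaussian ρ) (t : ℕ) :
    (∫ ρ, proxyDensity ρ ∂(evolve P t)) ≤ (1 + (t : ℝ) / n)⁻¹ :=
  le_inv_of_step_le (s := fun t => ∫ ρ, proxyDensity ρ ∂(evolve P t))
    (Nat.cast_pos.2 (NeZero.pos n)) (integral_proxyDensity_le_one (P := P) hP)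
    (fun t => integral_proxyDensity_nonneg (evolve_spec hP t).2)
    (integral_proxyDensity_evolve_succ_le hP) t

lemma integral_proxyEntropy_evolve_le (hP : ∀ᵐ ρ ∂P, IsNumberConservingGaussian ρ) (t : ℕ)
    {c : ℝ} (hc : 0 < c) (ht : c * (n : ℝ) ^ 2 ≤ t) :
    (∫ ρ, proxyEntropy ρ ∂(evolve P t)) ≤ Real.log 2 / c := by
  have hn : 0 < (n : ℝ) := Nat.cast_pos.2 (NeZero.pos n)
  have hlog : 0 < Real.log 2 := Real.log_pos one_lt_two
  have h1 := integral_proxyDensity_evolve_le hP t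
  simp only [proxyDensity] at h1
  rw [integral_div, div_le_iff₀ (by positivity)] at h1
  refine h1.trans ?_
  have h2 : (0 : ℝ) < 1 + t / n := by positivity
  rw [inv_mul_eq_div, div_le_div_iff₀ h2 hc]
  have h3 : c * n ≤ t / n := by
    rw [le_div_iff₀ hn]; linarith [sq (n : ℝ)]
  nlinarith

omit [NeZero n] in
/-- By Jensen's inequality, a small average proxy entropy forces a large average purity. -/
lemma exp_neg_integral_proxyEntropy_le (hP : ∀ᵐ ρ ∂P, IsNumberConservingGaussian ρ) :
    Real.exp (-∫ ρ, proxyEntropy ρ ∂P) ≤ ∫ ρ, purity ρ ∂P := by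
  have hc : Continuous fun ρ : FockOp n => -proxyEntropy ρ := continuous_proxyEntropy.neg
  have h1 := convexOn_exp.map_integral_le (μ := P) Real.continuous_exp.continuousOn isClosed_univ
    (by simp) (integrable_of_continuous hP hc)
    (integrable_of_continuous hP (Real.continuous_exp.comp hc))
  rw [integral_neg] at h1
  refine h1.trans (integral_mono_ae (integrable_of_continuous hP (Real.continuous_exp.comp hc))
    (integrable_of_continuous hP continuous_purity) ?_)
  filter_upwards [hP] with ρ hρ
  exact exp_neg_proxyEntropy_le_purity hρ

lemma rpow_le_integral_purity_evolve (hP : ∀ᵐ ρ ∂P, IsNumberConservingGaussian ρ) (t : ℕ)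
    {c : ℝ} (hc : 0 < c) (ht : c * (n : ℝ) ^ 2 ≤ t) :
    (2 : ℝ) ^ (-(1 / c)) ≤ ∫ ρ, purity ρ ∂(evolve P t) := by
  obtain ⟨_, h⟩ := evolve_spec hP t
  refine le_trans ?_ (exp_neg_integral_proxyEntropy_le h)
  rw [Real.rpow_def_of_pos two_pos, Real.exp_le_exp]
  have := integral_proxyEntropy_evolve_le hP t hc ht
  rw [mul_neg, mul_one_div]
  exact neg_le_neg this

end Circuit

end FreeFermion

end

theorem mainTheorem1 (n : ℕ) [NeZero n] :
    -- a single number-conserving Gaussian state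
    (∀ ρ : FreeFermion.FockOp n, FreeFermion.IsNumberConservingGaussian ρ →
      (FreeFermion.corr ρ).IsHermitian ∧
      (∀ x : Bool, FreeFermion.outcomeProb x ρ ≠ 0 →
        FreeFermion.IsNumberConservingGaussian (FreeFermion.postState x ρ)) ∧
      ((FreeFermion.corr ρ 0 0).re ^ 2 ≠ 1 →
        FreeFermion.proxyChange ρ =
          -(Real.log 2 / (1 - (FreeFermion.corr ρ 0 0).re ^ 2)) *
            (1 - ((FreeFermion.corr ρ * FreeFermion.corr ρ) 0 0).re) ^ 2) ∧
      ((FreeFermion.corr ρ 0 0).re ^ 2 = 1 → FreeFermion.proxyChange ρ = 0) ∧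
      FreeFermion.proxyChange ρ ≤ 0) ∧
    -- ensembles of number-conserving Gaussian states
    (∀ P : MeasureTheory.Measure (FreeFermion.FockOp n), MeasureTheory.IsProbabilityMeasure P →
      (∀ᵐ ρ ∂P, FreeFermion.IsNumberConservingGaussian ρ) →
      -- measuring an arbitrary ensemble
      (MeasureTheory.IsProbabilityMeasure (FreeFermion.measureStep P) ∧
        MeasureTheory.Integrable FreeFermion.proxyEntropy P ∧
        MeasureTheory.Integrable FreeFermion.proxyEntropy (FreeFermion.measureStep P) ∧
        MeasureTheory.Integrable (fun ρ : FreeFermion.FockOp n =>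
          1 - ((FreeFermion.corr ρ * FreeFermion.corr ρ) 0 0).re) P ∧
        MeasureTheory.Integrable (fun ρ : FreeFermion.FockOp n =>
          (1 - ((FreeFermion.corr ρ * FreeFermion.corr ρ) 0 0).re) ^ 2) P ∧
        Real.log 2 *
            ∫ ρ, (1 - ((FreeFermion.corr ρ * FreeFermion.corr ρ) 0 0).re) ^ 2 ∂P ≤
          |(∫ ρ, FreeFermion.proxyEntropy ρ ∂(FreeFermion.measureStep P)) -
            ∫ ρ, FreeFermion.proxyEntropy ρ ∂P| ∧
        Real.log 2 *
            (∫ ρ, (1 - ((FreeFermion.corr ρ * FreeFermion.corr ρ) 0 0).re) ∂P) ^ 2 ≤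
          Real.log 2 *
            ∫ ρ, (1 - ((FreeFermion.corr ρ * FreeFermion.corr ρ) 0 0).re) ^ 2 ∂P) ∧
      -- the circuit with Haar-random unitaries, started from the ensemble `P`
      (∀ t : ℕ,
        MeasureTheory.IsProbabilityMeasure (FreeFermion.evolve P t) ∧
        (∀ᵐ ρ ∂(FreeFermion.evolve P t), FreeFermion.IsNumberConservingGaussian ρ) ∧
        MeasureTheory.Integrable FreeFermion.proxyDensity (FreeFermion.evolve P t) ∧
        MeasureTheory.Integrable FreeFermion.purity (FreeFermion.evolve P t) ∧
        (∫ ρ, FreeFermion.proxyDensity ρ ∂(FreeFermion.evolve P (t + 1))) ≤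
          ∫ ρ, FreeFermion.proxyDensity ρ ∂(FreeFermion.evolve P t) ∧
        (1 / (n : ℝ)) * (∫ ρ, FreeFermion.proxyDensity ρ ∂(FreeFermion.evolve P t)) ^ 2 ≤
          |(∫ ρ, FreeFermion.proxyDensity ρ ∂(FreeFermion.evolve P (t + 1))) -
            ∫ ρ, FreeFermion.proxyDensity ρ ∂(FreeFermion.evolve P t)| ∧
        (∫ ρ, FreeFermion.proxyDensity ρ ∂(FreeFermion.evolve P t)) ≤
          (1 + (t : ℝ) / n)⁻¹ ∧
        -- purification in a time of order `n ^ 2`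
        (∀ c : ℝ, 0 < c → c * (n : ℝ) ^ 2 ≤ t →
          (∫ ρ, FreeFermion.proxyEntropy ρ ∂(FreeFermion.evolve P t)) ≤ Real.log 2 / c ∧
          (2 : ℝ) ^ (-(1 / c)) ≤ ∫ ρ, FreeFermion.purity ρ ∂(FreeFermion.evolve P t)))) := by
  refine ⟨fun ρ h => ⟨h.isHermitian_corr, fun x hx => h.postState x hx, h.proxyChange_eq,
    h.proxyChange_eq_zero, h.proxyChange_nonpos⟩, fun P _ hP => ⟨?_, fun t => ?_⟩⟩
  · have hc : Continuous fun ρ : FreeFermion.FockOp n =>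
        1 - ((FreeFermion.corr ρ * FreeFermion.corr ρ) 0 0).re :=
      continuous_const.sub (FreeFermion.continuous_corr_sq_re 0)
    have := FreeFermion.isProbabilityMeasure_measureStep hP
    refine ⟨this, FreeFermion.integrable_of_continuous hP FreeFermion.continuous_proxyEntropy,
      FreeFermion.integrable_of_continuous (FreeFermion.ae_measureStep hP)
        FreeFermion.continuous_proxyEntropy,
      FreeFermion.integrable_of_continuous hP hc,
      FreeFermion.integrable_of_continuous hP (hc.pow 2), ?_,
      mul_le_mul_of_nonneg_left (FreeFermion.sq_integral_le hP) (Real.log_nonneg one_le_two)⟩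
    exact (le_neg_of_le_neg (FreeFermion.integral_measureStep_sub_le hP)).trans (neg_le_abs _)
  · obtain ⟨h1, h2⟩ := FreeFermion.evolve_spec hP t
    have h3 := FreeFermion.integral_proxyDensity_evolve_succ_le hP t
    have h4 : 0 ≤ 1 / (n : ℝ) *
        (∫ ρ, FreeFermion.proxyDensity ρ ∂(FreeFermion.evolve P t)) ^ 2 := by positivity
    refine ⟨h1, h2, FreeFermion.integrable_of_continuous h2 FreeFermion.continuous_proxyDensity,
      FreeFermion.integrable_of_continuous h2 FreeFermion.continuous_purity, by linarith, ?_,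
      FreeFermion.integral_proxyDensity_evolve_le hP t, fun c hc ht =>
      ⟨FreeFermion.integral_proxyEntropy_evolve_le hP t hc ht,
        FreeFermion.rpow_le_integral_purity_evolve hP t hc ht⟩⟩
    exact le_trans (by linarith) (neg_le_abs _)
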